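/- Let $n\ge 3$ and let $M$ be a smooth (Hausdorff, second countable) $n$-dimensional manifold without boundary; metrics, vector fields, forms and connections are smooth. For a Riemannian metric $g=\langle\cdot,\cdot\rangle$ on $M$ with Levi-Civita connection $\nabla^g$ and a vector field $V$ on $M$, put $$\nabla_XY=\nabla^g_XY+\langle X,Y\rangle V-\langle V,Y\rangle X,\qquad \nabla^w_XY=\nabla^g_XY-\langle X,V\rangle Y-\langle Y,V\rangle X+\langle X,Y\rangle V .$$ A connection of the form $\nabla$ is called a metric connection with vectorial torsion on $(M,g)$; $\nabla^w$ is called the Weyl connection of $(g,V)$. A Weyl structure on $M$ is a pair $(c,D)$ of a conformal class $c$ of Riemannian metrics and a torsion-free connection $D$ on $TM$ such that for every $g\in c$ there is a 1-form $\theta_g$ with $Dg=-2\theta_g\otimes g$. It is closed if $d\theta_g=0$ for all $g\in c$, and flat if the curvature of $D$ vanishes. (1) The connection $\nabla$ given by $(g,V)$ is flat if and only if $dV^\flat=0$, where $V^\flat=\langle V,\cdot\rangle$, and the Weyl connection $\nabla^w$ of $(g,V)$ is flat. (2) There is a map $\Phi$ from the set of pairs $(g,\nabla)$, with $g$ a Riemannian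 metric on $M$ and $\nabla$ a flat metric connection with vectorial torsion on $(M,g)$, to the set of closed flat Weyl structures on $M$, such that $\Phi(g,\nabla)=([g],\nabla^w)$, where $\nabla^w$ is the Weyl connection of $(g,V)$ for any vector field $V$ that defines $\nabla$. For every closed flat Weyl structure $(c,D)$ and every $g\in c$ there is exactly one such $\nabla$ on $(M,g)$ with $\Phi(g,\nabla)=(c,D)$. (3) If $(M,g)$ admits a flat metric connection with vectorial torsion, then $(M,g)$ is locally conformally flat: every point has an open neighbourhood $U$ and a smooth function $f$ on $U$ such that the metric $e^{2f}g$ on $U$ is flat. -/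

import Mathlib

open Set Bundle
open scoped Manifold ContDiff Topology

noncomputable section

namespace VectorialTorsion

/-- A smooth Riemannian metric on the `n`-dimensional manifold `M`. -/
abbrev RiemMetric (n : ℕ) (M : Type*) [TopologicalSpace M]
    [ChartedSpace (EuclideanSpace ℝ (Fin n)) M] [IsManifold (𝓡 n) ∞ M] :=
  ContMDiffRiemannianMetric (𝓡 n) ∞ (EuclideanSpace ℝ (Fin n))
    (fun x : M => TangentSpace (𝓡 n) x)

variable {n : ℕ} {M : Type*} [TopologicalSpace M]
  [ChartedSpace (EuclideanSpace ℝ (Fin n)) M] [IsManifold (𝓡 n) ∞ M]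

/-- `X` is a smooth vector field on `M`. -/
def IsSmoothField (X : Π x : M, TangentSpace (𝓡 n) x) : Prop :=
  ContMDiff (𝓡 n) ((𝓡 n).prod 𝓘(ℝ, EuclideanSpace ℝ (Fin n))) ∞
    (fun x => (⟨x, X x⟩ : TangentBundle (𝓡 n) M))

/-- The vector field `X` is differentiable at the point `x`. -/
def IsDiffFieldAt (X : Π x : M, TangentSpace (𝓡 n) x) (x : M) : Prop :=
  MDifferentiableAt (𝓡 n) ((𝓡 n).prod 𝓘(ℝ, EuclideanSpace ℝ (Fin n)))
    (fun y => (⟨y, X y⟩ : TangentBundle (𝓡 n) M)) x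

/-- `θ` is a smooth 1-form on `M`. -/
def IsSmoothOneForm (θ : Π x : M, TangentSpace (𝓡 n) x →L[ℝ] ℝ) : Prop :=
  ContMDiff (𝓡 n) ((𝓡 n).prod 𝓘(ℝ, EuclideanSpace ℝ (Fin n) →L[ℝ] ℝ)) ∞
    (fun x => TotalSpace.mk' (EuclideanSpace ℝ (Fin n) →L[ℝ] ℝ)
      (E := fun x : M => TangentSpace (𝓡 n) x →L[ℝ] ℝ) x (θ x))

/-- The value at `x` of the exterior derivative,
`dθ(X, Y) = X(θ(Y)) - Y(θ(X)) - θ([X, Y])`, of a smooth 1-form on smooth vector fields. -/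
def extDerivOneForm (θ : Π x : M, TangentSpace (𝓡 n) x →L[ℝ] ℝ)
    (X Y : Π x : M, TangentSpace (𝓡 n) x) (x : M) : ℝ :=
  mvfderiv (𝓡 n) (fun y => θ y (Y y)) x (X x)
    - mvfderiv (𝓡 n) (fun y => θ y (X y)) x (Y x)
    - θ x (VectorField.mlieBracket (𝓡 n) X Y x)

/-- `dθ = 0`. -/
def IsClosedOneForm (θ : Π x : M, TangentSpace (𝓡 n) x →L[ℝ] ℝ) : Prop :=
  ∀ X Y : Π x : M, TangentSpace (𝓡 n) x, IsSmoothField X → IsSmoothField Y →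
    ∀ x, extDerivOneForm θ X Y x = 0

/-- The type of the operators `Y ↦ (x ↦ (u ↦ (∇_u Y)(x)))`, in the argument order of
Mathlib's covariant derivatives: `C Y x u` is `(∇_u Y)(x)`, for `u` a tangent vector at `x`. -/
abbrev ConnOperator (n : ℕ) (M : Type*) [TopologicalSpace M]
    [ChartedSpace (EuclideanSpace ℝ (Fin n)) M] :=
  (Π x : M, TangentSpace (𝓡 n) x) → (Π x : M, TangentSpace (𝓡 n) x →L[ℝ] TangentSpace (𝓡 n) x)

/-- The curvature `R(X, Y)Z = ∇_X ∇_Y Z - ∇_Y ∇_X Z - ∇_[X, Y] Z` at `x`. -/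
def curvature (C : ConnOperator n M) (X Y Z : Π x : M, TangentSpace (𝓡 n) x) (x : M) :
    TangentSpace (𝓡 n) x :=
  C (fun y => C Z y (Y y)) x (X x) - C (fun y => C Z y (X y)) x (Y x)
    - C Z x (VectorField.mlieBracket (𝓡 n) X Y x)

/-- The curvature vanishes at all points of `U`. -/
def IsFlatOn (C : ConnOperator n M) (U : Set M) : Prop :=
  ∀ X Y Z : Π x : M, TangentSpace (𝓡 n) x,
    IsSmoothField X → IsSmoothField Y → IsSmoothField Z →
      ∀ x ∈ U, curvature C X Y Z x = 0

/-- The torsion `∇_X Y - ∇_Y X - [X, Y]` vanishes at all points of `U`. -/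
def IsTorsionFreeOn (C : ConnOperator n M) (U : Set M) : Prop :=
  ∀ X Y : Π x : M, TangentSpace (𝓡 n) x, ∀ x ∈ U, IsDiffFieldAt X x → IsDiffFieldAt Y x →
    C Y x (X x) - C X x (Y x) = VectorField.mlieBracket (𝓡 n) X Y x

/-- The derivative of the family `h` of bilinear forms,
`(∇_u h)(Y, Z) = u(h(Y, Z)) - h(∇_u Y, Z) - h(Y, ∇_u Z)`, at the point `x`. -/
def derivForm (h : Π x : M, TangentSpace (𝓡 n) x →L[ℝ] TangentSpace (𝓡 n) x →L[ℝ] ℝ)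
    (C : ConnOperator n M) (Y Z : Π x : M, TangentSpace (𝓡 n) x) (x : M)
    (u : TangentSpace (𝓡 n) x) : ℝ :=
  mvfderiv (𝓡 n) (fun y => h y (Y y) (Z y)) x u
    - h x (C Y x u) (Z x) - h x (Y x) (C Z x u)

/-- `∇h = 0` at all points of `U`. -/
def IsMetricOn (h : Π x : M, TangentSpace (𝓡 n) x →L[ℝ] TangentSpace (𝓡 n) x →L[ℝ] ℝ)
    (C : ConnOperator n M) (U : Set M) : Prop :=
  ∀ Y Z : Π x : M, TangentSpace (𝓡 n) x, ∀ x ∈ U, IsDiffFieldAt Y x → IsDiffFieldAt Z x →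
    ∀ u : TangentSpace (𝓡 n) x, derivForm h C Y Z x u = 0

/-- `C` is, over the open set `U`, the Levi-Civita connection of the metric `h`: a smooth
covariant derivative that is torsion-free and for which `h` is parallel. -/
structure IsLeviCivitaOn
    (h : Π x : M, TangentSpace (𝓡 n) x →L[ℝ] TangentSpace (𝓡 n) x →L[ℝ] ℝ)
    (C : ConnOperator n M) (U : Set M) : Prop where
  covariantDerivative : IsCovariantDerivativeOn (EuclideanSpace ℝ (Fin n)) C U
  smooth : ContMDiffCovariantDerivativeOn (EuclideanSpace ℝ (Fin n)) ∞ C U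
  torsionFree : IsTorsionFreeOn C U
  metric : IsMetricOn h C U

variable (n M) in
/-- A smooth connection on the tangent bundle. Mathlib's covariant derivatives are defined on all
sections, with unconstrained values where a section is not differentiable; these values are put to
zero here, so that two connections are equal as soon as they agree on differentiable fields. -/
structure AffineConnection extends
    CovariantDerivative (𝓡 n) (EuclideanSpace ℝ (Fin n))
      (TangentSpace (𝓡 n) : M → Type _) where
  smooth : CovariantDerivative.ContMDiffCovariantDerivative toCovariantDerivative ∞
  junk : ∀ (Y : Π x : M, TangentSpace (𝓡 n) x) (x : M), ¬ IsDiffFieldAt Y x → toFun Y x = 0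

/-- Torsion-freeness is the vanishing of Mathlib's torsion tensor. -/
theorem isTorsionFreeOn_univ_iff (C : AffineConnection n M) :
    IsTorsionFreeOn C.toFun univ ↔
      C.toCovariantDerivative.torsion = 0 := by
  rw [CovariantDerivative.torsion_eq_zero_iff]
  exact ⟨fun h X Y x hX hY => h X Y x (mem_univ x) hX hY,
    fun h X Y x _ hX hY => h hX hY⟩

/-- A connection is determined by its values on differentiable vector fields. -/
theorem AffineConnection.ext_of_mdiff {C C' : AffineConnection n M}
    (h : ∀ (Y : Π x : M, TangentSpace (𝓡 n) x) (x : M), IsDiffFieldAt Y x →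
      C.toFun Y x = C'.toFun Y x) : C = C' := by
  have key : C.toFun = C'.toFun := by
    funext Y x
    by_cases hY : IsDiffFieldAt Y x
    · exact h Y x hY
    · rw [C.junk Y x hY, C'.junk Y x hY]
  obtain ⟨⟨f, _⟩, _, _⟩ := C
  obtain ⟨⟨f', _⟩, _, _⟩ := C'
  obtain rfl : f = f' := key
  rfl

/-- The connection has vanishing curvature. -/
def AffineConnection.IsFlat (C : AffineConnection n M) : Prop := IsFlatOn C.toFun univ

/-- `L` is the Levi-Civita connection `∇^g` of the Riemannian metric `g`. -/
def IsLeviCivita (g : RiemMetric n M) (L : AffineConnection n M) : Prop :=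
  IsLeviCivitaOn g.inner L.toFun univ

/-- `C` is the metric connection with vectorial torsion given by `g` and the vector field `V`:
`∇_X Y = ∇^g_X Y + g(X, Y) V - g(V, Y) X`. -/
def IsVectorialConnection (g : RiemMetric n M) (V : Π x : M, TangentSpace (𝓡 n) x)
    (C : AffineConnection n M) : Prop :=
  IsSmoothField V ∧ ∃ L : AffineConnection n M, IsLeviCivita g L ∧
    ∀ (Y : Π x : M, TangentSpace (𝓡 n) x) (x : M), IsDiffFieldAt Y x →
      ∀ u : TangentSpace (𝓡 n) x,
        C.toFun Y x u = L.toFun Y x u + g.inner x u (Y x) • V x - g.inner x (V x) (Y x) • u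

/-- `D` is the Weyl connection given by `g` and the vector field `V`:
`D_X Y = ∇^g_X Y - g(X, V) Y - g(Y, V) X + g(X, Y) V`. -/
def IsWeylConnection (g : RiemMetric n M) (V : Π x : M, TangentSpace (𝓡 n) x)
    (D : AffineConnection n M) : Prop :=
  IsSmoothField V ∧ ∃ L : AffineConnection n M, IsLeviCivita g L ∧
    ∀ (Y : Π x : M, TangentSpace (𝓡 n) x) (x : M), IsDiffFieldAt Y x →
      ∀ u : TangentSpace (𝓡 n) x,
        D.toFun Y x u = L.toFun Y x u - g.inner x u (V x) • Y x - g.inner x (Y x) (V x) • u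
          + g.inner x u (Y x) • V x

variable (n M) in
/-- A Riemannian metric on `M` together with a flat metric connection with vectorial torsion. -/
structure FlatVectorialStructure where
  metric : RiemMetric n M
  connection : AffineConnection n M
  vectorial : ∃ V : Π x : M, TangentSpace (𝓡 n) x, IsVectorialConnection metric V connection
  flat : connection.IsFlat

/-- `g' = e^{2f} g` for a smooth function `f`. -/
def IsConformal (g g' : RiemMetric n M) : Prop :=
  ∃ f : M → ℝ, ContMDiff (𝓡 n) 𝓘(ℝ, ℝ) ∞ f ∧ ∀ (x : M) (v w : TangentSpace (𝓡 n) x),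
    g'.inner x v w = Real.exp (2 * f x) * g.inner x v w

variable (n M) in
/-- Conformal equivalence of Riemannian metrics. -/
def conformalSetoid : Setoid (RiemMetric n M) where
  r := IsConformal
  iseqv := by
    refine ⟨fun g => ⟨fun _ => 0, contMDiff_const, by simp⟩, ?_, ?_⟩
    · rintro g g' ⟨f, hf, h⟩
      refine ⟨fun x => - f x, hf.neg, fun x v w => ?_⟩
      rw [h, ← mul_assoc, ← Real.exp_add]
      simp
    · rintro g g' g'' ⟨f, hf, h⟩ ⟨f', hf', h'⟩
      refine ⟨fun x => f x + f' x, hf.add hf', fun x v w => ?_⟩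
      rw [h', h, ← mul_assoc, ← Real.exp_add]
      ring_nf

variable (n M) in
/-- A conformal class of Riemannian metrics on `M`. -/
def ConformalClass := Quotient (conformalSetoid n M)

/-- The conformal class `[g]` of a metric `g`. -/
def conformalClass (g : RiemMetric n M) : ConformalClass n M :=
  Quotient.mk (conformalSetoid n M) g

/-- `θ` is the Lee form of the connection `D` with respect to `g`: `D g = -2 θ ⊗ g`. -/
def IsLeeForm (g : RiemMetric n M) (D : AffineConnection n M)
    (θ : Π x : M, TangentSpace (𝓡 n) x →L[ℝ] ℝ) : Prop :=
  IsSmoothOneForm θ ∧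
    ∀ (Y Z : Π x : M, TangentSpace (𝓡 n) x) (x : M), IsDiffFieldAt Y x → IsDiffFieldAt Z x →
      ∀ u : TangentSpace (𝓡 n) x,
        derivForm g.inner D.toFun Y Z x u = -2 * θ x u * g.inner x (Y x) (Z x)

variable (n M) in
/-- A Weyl structure on `M`: a conformal class of Riemannian metrics and a torsion-free connection
that preserves it. -/
structure WeylStructure where
  cls : ConformalClass n M
  connection : AffineConnection n M
  torsionFree : IsTorsionFreeOn connection.toFun univ
  preserves : ∀ g : RiemMetric n M, conformalClass g = cls → ∃ θ, IsLeeForm g connection θ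

/-- A Weyl structure is closed if the Lee forms of the metrics in its conformal class are. -/
def WeylStructure.IsClosedWeyl (W : WeylStructure n M) : Prop :=
  ∀ (g : RiemMetric n M) (θ : Π x : M, TangentSpace (𝓡 n) x →L[ℝ] ℝ),
    conformalClass g = W.cls → IsLeeForm g W.connection θ → IsClosedOneForm θ

/-- A Weyl structure is flat if its connection is. -/
def WeylStructure.IsFlatWeyl (W : WeylStructure n M) : Prop := W.connection.IsFlat

/-- `(M, g)` is locally conformally flat: every point has an open neighbourhood `U` with a smooth
function `f` on `U` such that the metric `e^{2f} g` on `U` is flat. -/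
def IsLocallyConformallyFlat (g : RiemMetric n M) : Prop :=
  ∀ p : M, ∃ U : Set M, IsOpen U ∧ p ∈ U ∧ ∃ f : M → ℝ, ContMDiffOn (𝓡 n) 𝓘(ℝ, ℝ) ∞ f U ∧
    ∃ C : ConnOperator n M,
      IsLeviCivitaOn (fun x => Real.exp (2 * f x) • g.inner x) C U ∧ IsFlatOn C U

end VectorialTorsion

end

/-! Everything rests on the identity `∇^w = ∇ - V^♭ ⊗ Id`. Changing a connection by a multiple of
the identity changes its curvature only by an exterior derivative: `R^w(X, Y)Z = R(X, Y)Z - dV^♭(X,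
Y) Z` (`curvature_sub_oneForm`). So if `V^♭` is closed, one connection is flat exactly when the
other is. If only `R = 0` is known, then, as `∇^w` is torsion-free, the first Bianchi identity
(`curvature_add_cyclic`) says that the cyclic sum of `dV^♭(X, Y) Z` vanishes; since `n ≥ 3`, `Z` can
be chosen outside the span of `X` and `Y`, which forces `dV^♭(X, Y) = 0`.

For the correspondence, the Lee form of `∇^w` with respect to `g` is `-V^♭`, and passing to `e^{2f}
g` subtracts the closed form `df`, so closedness does not depend on the metric in the class.
Conversely, a torsion-free `D` with Lee form `θ` is the Weyl connection of `(g, V)` for `V^♭ = -θ`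
(`IsWeylConnection.of_isLeeForm`), and `∇ = D + V^♭ ⊗ Id`. Uniqueness holds because the Lee form
recovers `V` and the Levi-Civita connection is unique.

Local conformal flatness is the Poincaré lemma: where `df = -V^♭`, the Weyl connection is the
Levi-Civita connection of `e^{2f} g`, and it is flat. -/

section HomBundle

/-! ### Smoothness of sections of homomorphism bundles -/

variable {E H M F₁ F₂ : Type*} [NormedAddCommGroup E] [NormedSpace ℝ E] [TopologicalSpace H]
  {I : ModelWithCorners ℝ E H} [TopologicalSpace M] [ChartedSpace H M]
  [NormedAddCommGroup F₁] [NormedSpace ℝ F₁] [NormedAddCommGroup F₂] [NormedSpace ℝ F₂]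

/-- A map into a space of linear maps out of a finite-dimensional space is `C^k` as soon as its
evaluations are. -/
theorem contMDiffAt_of_forall_clm_apply [FiniteDimensional ℝ F₁] {k : ℕ∞ω}
    {f : M → F₁ →L[ℝ] F₂} {x : M}
    (h : ∀ v, ContMDiffAt I 𝓘(ℝ, F₂) k (fun y => f y v) x) :
    ContMDiffAt I 𝓘(ℝ, F₁ →L[ℝ] F₂) k f x := by
  classical
  let b := Module.finBasis ℝ F₁
  let c : Fin (Module.finrank ℝ F₁) → F₁ →L[ℝ] ℝ := fun i => (b.coord i).toContinuousLinearMap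
  -- Expansion in a basis: `f y` is a finite sum of fixed continuous linear images of the values `f
  -- y (b i)`.
  have key : f = fun y => ∑ i, ContinuousLinearMap.smulRightL ℝ F₁ F₂ (c i) (f y (b i)) := by
    funext y
    ext v
    conv_lhs => rw [← b.sum_repr v, map_sum]
    simp [c]
  rw [key]
  refine contMDiffAt_finsetSum fun i _ => ?_
  exact ((ContinuousLinearMap.smulRightL ℝ F₁ F₂ (c i)).contMDiff.contMDiffAt).comp x (h (b i))

variable {E₁ E₂ : M → Type*}
  [TopologicalSpace (TotalSpace F₁ E₁)] [∀ x, AddCommGroup (E₁ x)] [∀ x, Module ℝ (E₁ x)]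
  [∀ x, TopologicalSpace (E₁ x)] [FiberBundle F₁ E₁] [VectorBundle ℝ F₁ E₁]
  [TopologicalSpace (TotalSpace F₂ E₂)] [∀ x, AddCommGroup (E₂ x)] [∀ x, Module ℝ (E₂ x)]
  [∀ x, TopologicalSpace (E₂ x)] [∀ x, IsTopologicalAddGroup (E₂ x)]
  [∀ x, ContinuousSMul ℝ (E₂ x)] [FiberBundle F₂ E₂] [VectorBundle ℝ F₂ E₂]

/-- A section of a bundle of homomorphisms is `C^k` at a point as soon as its values on `C^k`
sections are. -/
theorem contMDiffAt_hom_section_of_forall_apply [FiniteDimensional ℝ F₁] {k : ℕ∞ω}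
    [ContMDiffVectorBundle k F₁ E₁ I]
    {T : Π x, E₁ x →L[ℝ] E₂ x} {x₀ : M}
    (h : ∀ X : Π x, E₁ x,
      ContMDiffAt I (I.prod 𝓘(ℝ, F₁)) k (fun x => (⟨x, X x⟩ : TotalSpace F₁ E₁)) x₀ →
      ContMDiffAt I (I.prod 𝓘(ℝ, F₂)) k (fun x => (⟨x, T x (X x)⟩ : TotalSpace F₂ E₂)) x₀) :
    ContMDiffAt I (I.prod 𝓘(ℝ, F₁ →L[ℝ] F₂)) k
      (fun x => TotalSpace.mk' (F₁ →L[ℝ] F₂) (E := fun x => E₁ x →L[ℝ] E₂ x) x (T x)) x₀ := by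
  refine (contMDiffAt_hom_bundle _).2 ⟨contMDiffAt_id, ?_⟩
  refine contMDiffAt_of_forall_clm_apply fun v => ?_
  -- `X` has constant coordinate `v` in the trivialization at `x₀`, so near `x₀` the coordinates of
  -- `T X` are the local expression of `T` applied to `v`.
  let X : Π x, E₁ x := FiberBundle.extend F₁ ((trivializationAt F₁ E₁ x₀).symm x₀ v)
  have hX := h X (FiberBundle.contMDiffAt_extend I F₁ _)
  rw [contMDiffAt_section] at hX
  have hm₁ := (trivializationAt F₁ E₁ x₀).open_baseSet.mem_nhds
    (FiberBundle.mem_baseSet_trivializationAt' (F := F₁) (E := E₁) x₀)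
  have hm₂ := (trivializationAt F₂ E₂ x₀).open_baseSet.mem_nhds
    (FiberBundle.mem_baseSet_trivializationAt' (F := F₂) (E := E₂) x₀)
  refine hX.congr_of_eventuallyEq ?_
  filter_upwards [hm₁, hm₂] with y hy₁ hy₂
  have hx₀ := FiberBundle.mem_baseSet_trivializationAt' (F := F₁) (E := E₁) x₀
  rw [ContinuousLinearMap.inCoordinates_eq hy₁ hy₂]
  simp [X, FiberBundle.extend, Trivialization.apply_mk_symm, hx₀]

end HomBundle

/-! ### Vector fields, one-forms and metric duality -/

namespace VectorialTorsion

variable {n : ℕ} {M : Type*} [TopologicalSpace M]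
  [ChartedSpace (EuclideanSpace ℝ (Fin n)) M] [IsManifold (𝓡 n) ∞ M]

/-- Every tangent vector is the value of a smooth vector field. -/
theorem exists_isSmoothField_apply_eq [T2Space M] {x : M} (v : TangentSpace (𝓡 n) x) :
    ∃ X : Π x : M, TangentSpace (𝓡 n) x, IsSmoothField X ∧ X x = v := by
  obtain ⟨s, hs, hX⟩ := FiberBundle.exists_contMDiffOn_extend (k := ∞) (𝓡 n)
    (EuclideanSpace ℝ (Fin n)) v
  obtain ⟨u, hus, hu, hxu⟩ := mem_nhds_iff.1 hs
  obtain ⟨ψ, -, hψ⟩ := (SmoothBumpFunction.nhds_basis_tsupport (I := 𝓡 n) x).mem_iff.1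
    (hu.mem_nhds hxu)
  refine ⟨(ψ : M → ℝ) • FiberBundle.extend (EuclideanSpace ℝ (Fin n)) v, ?_, ?_⟩
  · exact ContMDiffOn.smul_section_of_tsupport ψ.contMDiff.contMDiffOn hu hψ (hX.mono hus)
  · simp

/-- Smooth vector fields are differentiable. -/
theorem IsSmoothField.isDiffFieldAt {X : Π x : M, TangentSpace (𝓡 n) x} (hX : IsSmoothField X)
    (x : M) : IsDiffFieldAt X x :=
  (hX x).mdifferentiableAt (by simp)

/-- A one-form is smooth at a point as soon as its values on smooth fields are. -/
theorem contMDiffAt_oneForm_of_forall_apply {θ : Π x : M, TangentSpace (𝓡 n) x →L[ℝ] ℝ} {x₀ : M}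
    (h : ∀ X : Π x : M, TangentSpace (𝓡 n) x,
      ContMDiffAt (𝓡 n) ((𝓡 n).prod 𝓘(ℝ, EuclideanSpace ℝ (Fin n))) ∞
        (fun x => (⟨x, X x⟩ : TangentBundle (𝓡 n) M)) x₀ →
      ContMDiffAt (𝓡 n) 𝓘(ℝ, ℝ) ∞ (fun x => θ x (X x)) x₀) :
    ContMDiffAt (𝓡 n) ((𝓡 n).prod 𝓘(ℝ, EuclideanSpace ℝ (Fin n) →L[ℝ] ℝ)) ∞
      (fun x => TotalSpace.mk' (EuclideanSpace ℝ (Fin n) →L[ℝ] ℝ)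
        (E := fun x : M => TangentSpace (𝓡 n) x →L[ℝ] ℝ) x (θ x)) x₀ := by
  refine contMDiffAt_hom_section_of_forall_apply (E₂ := Bundle.Trivial M ℝ) fun X hX => ?_
  rw [contMDiffAt_section]
  exact h X hX

/-- The value of a smooth one-form on a smooth vector field along a map. -/
theorem contMDiffAt_oneForm_apply {E' H' M' : Type*} [NormedAddCommGroup E'] [NormedSpace ℝ E']
    [TopologicalSpace H'] {I' : ModelWithCorners ℝ E' H'} [TopologicalSpace M']
    [ChartedSpace H' M']
    {b : M' → M} {θ : Π x : M', TangentSpace (𝓡 n) (b x) →L[ℝ] ℝ}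
    {X : Π x : M', TangentSpace (𝓡 n) (b x)} {x₀ : M'} {k : ℕ∞ω}
    (hθ : ContMDiffAt I' ((𝓡 n).prod 𝓘(ℝ, EuclideanSpace ℝ (Fin n) →L[ℝ] ℝ)) k
      (fun x => TotalSpace.mk' (EuclideanSpace ℝ (Fin n) →L[ℝ] ℝ)
        (E := fun x : M => TangentSpace (𝓡 n) x →L[ℝ] ℝ) (b x) (θ x)) x₀)
    (hX : ContMDiffAt I' ((𝓡 n).prod 𝓘(ℝ, EuclideanSpace ℝ (Fin n))) k
        (fun x => (⟨b x, X x⟩ : TangentBundle (𝓡 n) M)) x₀) :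
    ContMDiffAt I' 𝓘(ℝ, ℝ) k (fun x => θ x (X x)) x₀ := by
  have h := ContMDiffAt.clm_bundle_apply (E₂ := Bundle.Trivial M ℝ) hθ hX
  rw [Bundle.contMDiffAt_totalSpace] at h
  exact h.2

/-- The product of two vector fields for a Riemannian metric is as smooth as they are. -/
theorem RiemMetric.contMDiffAt_inner (g : RiemMetric n M) {X Y : Π x : M, TangentSpace (𝓡 n) x}
    {x₀ : M}
    (hX : ContMDiffAt (𝓡 n) ((𝓡 n).prod 𝓘(ℝ, EuclideanSpace ℝ (Fin n))) ∞
        (fun x => (⟨x, X x⟩ : TangentBundle (𝓡 n) M)) x₀)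
    (hY : ContMDiffAt (𝓡 n) ((𝓡 n).prod 𝓘(ℝ, EuclideanSpace ℝ (Fin n))) ∞
        (fun x => (⟨x, Y x⟩ : TangentBundle (𝓡 n) M)) x₀) :
    ContMDiffAt (𝓡 n) 𝓘(ℝ, ℝ) ∞ (fun x => g.inner x (X x) (Y x)) x₀ := by
  have h := ContMDiffAt.clm_bundle_apply₂ (E₃ := Bundle.Trivial M ℝ) (g.contMDiff x₀) hX hY
  rw [Bundle.contMDiffAt_totalSpace] at h
  exact h.2

theorem RiemMetric.mdifferentiableAt_inner (g : RiemMetric n M)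
    {X Y : Π x : M, TangentSpace (𝓡 n) x} {x₀ : M}
    (hX : IsDiffFieldAt X x₀) (hY : IsDiffFieldAt Y x₀) :
    MDifferentiableAt (𝓡 n) 𝓘(ℝ, ℝ) (fun x => g.inner x (X x) (Y x)) x₀ := by
  have h := MDifferentiableAt.clm_bundle_apply₂ (E₃ := Bundle.Trivial M ℝ)
    ((g.contMDiff x₀).mdifferentiableAt (by simp)) hX hY
  rw [mdifferentiableAt_totalSpace] at h
  exact h.2

/-- The one-form metrically dual to a smooth vector field is smooth. -/
theorem RiemMetric.isSmoothOneForm_flat (g : RiemMetric n M)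
    {V : Π x : M, TangentSpace (𝓡 n) x} (hV : IsSmoothField V) :
    IsSmoothOneForm (fun x => g.inner x (V x)) := fun x =>
  contMDiffAt_oneForm_of_forall_apply fun _ hX => g.contMDiffAt_inner (hV x) hX

/-- The vector field metrically dual to a smooth one-form is smooth. -/
theorem RiemMetric.isSmoothField_of_flat (g : RiemMetric n M)
    {V : Π x : M, TangentSpace (𝓡 n) x} (hV : IsSmoothOneForm (fun x => g.inner x (V x))) :
    IsSmoothField V := by
  intro x₀
  rw [contMDiffAt_section]
  let F := EuclideanSpace ℝ (Fin n)
  let e := trivializationAt F (TangentSpace (𝓡 n) : M → Type _) x₀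
  have hx₀ : x₀ ∈ e.baseSet := FiberBundle.mem_baseSet_trivializationAt' x₀
  let s : Π x : M, F →L[ℝ] TangentSpace (𝓡 n) x := fun x => e.symmL ℝ x
  let S : F → Π x : M, TangentSpace (𝓡 n) x := fun v x => s x v
  have hS : ∀ v, ContMDiffAt (𝓡 n) ((𝓡 n).prod 𝓘(ℝ, F)) ∞
      (fun x => (⟨x, S v x⟩ : TangentBundle (𝓡 n) M)) x₀ := by
    intro v
    rw [e.contMDiffAt_section_iff hx₀]
    refine (contMDiffAt_const (c := v)).congr_of_eventuallyEq ?_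
    filter_upwards [e.open_baseSet.mem_nhds hx₀] with y hy
    simp [S, s, e.symmL_apply, hy, Trivialization.apply_mk_symm]
  -- `B` is the Gram form of the metric in a local frame and `η` the dual one-form. The coordinates
  -- of `V` are `B⁻¹ η`: positivity makes `B` injective, equality of dimensions makes it invertible,
  -- and inversion is smooth at invertible maps.
  let B : M → F →L[ℝ] F →L[ℝ] ℝ := fun x =>
    (ContinuousLinearMap.precomp ℝ (s x)).comp ((g.inner x).comp (s x))
  let η : M → F →L[ℝ] ℝ := fun x => (g.inner x (V x)).comp (s x)
  have hB : ContMDiffAt (𝓡 n) 𝓘(ℝ, F →L[ℝ] F →L[ℝ] ℝ) ∞ B x₀ := by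
    refine contMDiffAt_of_forall_clm_apply fun v => contMDiffAt_of_forall_clm_apply fun w => ?_
    exact g.contMDiffAt_inner (hS v) (hS w)
  have hη : ContMDiffAt (𝓡 n) 𝓘(ℝ, F →L[ℝ] ℝ) ∞ η x₀ :=
    contMDiffAt_of_forall_clm_apply fun v =>
      contMDiffAt_oneForm_apply (b := fun x => x) (X := S v) (hV x₀) (hS v)
  have hinv : ∀ x ∈ e.baseSet, (B x).IsInvertible := by
    intro x hx
    have hinj : Function.Injective (B x) := by
      refine (injective_iff_map_eq_zero _).2 fun v hv => ?_
      by_contra hv0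
      have h1 : s x v ≠ 0 := by
        intro h0
        apply hv0
        have := e.continuousLinearMapAt_symmL (R := ℝ) hx v
        rw [← this]
        change e.continuousLinearMapAt ℝ x (s x v) = 0
        rw [h0, map_zero]
      have h2 := g.pos x _ h1
      have h3 : B x v v = 0 := by rw [hv]; rfl
      exact h2.ne' h3
    have hfr : Module.finrank ℝ F = Module.finrank ℝ (F →L[ℝ] ℝ) := by
      rw [← LinearMap.toContinuousLinearMap.finrank_eq]
      exact (Subspace.dual_finrank_eq).symm
    let L : F ≃ₗ[ℝ] (F →L[ℝ] ℝ) :=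
      LinearEquiv.ofInjectiveOfFinrankEq (B x : F →ₗ[ℝ] (F →L[ℝ] ℝ)) hinj hfr
    exact ⟨L.toContinuousLinearEquiv, by ext; rfl⟩
  obtain ⟨A, hA⟩ := hinv x₀ hx₀
  have hBi : ContMDiffAt (𝓡 n) 𝓘(ℝ, (F →L[ℝ] ℝ) →L[ℝ] F) ∞ (fun x => (B x).inverse) x₀ :=
    ContMDiffAt.comp x₀ (g := ContinuousLinearMap.inverse)
      (hA ▸ (contDiffAt_map_inverse A).contMDiffAt) hB
  refine (hBi.clm_apply hη).congr_of_eventuallyEq ?_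
  filter_upwards [e.open_baseSet.mem_nhds hx₀] with y hy
  have h1 : B y (e ⟨y, V y⟩).2 = η y := by
    ext v
    change g.inner y (s y _) _ = g.inner y (V y) _
    congr 2
    change e.symmL ℝ y _ = _
    rw [e.symmL_apply hy]
    exact e.symm_apply_apply_mk hy (V y)
  rw [← h1]
  exact ((hinv y hy).inverse_apply_eq.2 rfl).symm

/-- Every one-form is the metric dual of a vector field. -/
theorem RiemMetric.exists_flat_eq (g : RiemMetric n M)
    (θ : Π x : M, TangentSpace (𝓡 n) x →L[ℝ] ℝ) :
    ∃ V : Π x : M, TangentSpace (𝓡 n) x, ∀ x, g.inner x (V x) = θ x := by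
  have : ∀ x : M, ∃ v : TangentSpace (𝓡 n) x, g.inner x v = θ x := by
    intro x
    have : FiniteDimensional ℝ (TangentSpace (𝓡 n) x) :=
      inferInstanceAs (FiniteDimensional ℝ (EuclideanSpace ℝ (Fin n)))
    let Q : TangentSpace (𝓡 n) x →ₗ[ℝ] Module.Dual ℝ (TangentSpace (𝓡 n) x) :=
      (ContinuousLinearMap.coeLM ℝ).comp (g.inner x : _ →ₗ[ℝ] _)
    have hinj : Function.Injective Q := by
      refine (injective_iff_map_eq_zero _).2 fun v hv => ?_
      by_contra hv0
      exact (g.pos x v hv0).ne' (LinearMap.congr_fun hv v)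
    have hsurj := (LinearMap.injective_iff_surjective_of_finrank_eq_finrank
      (Subspace.dual_finrank_eq (K := ℝ) (V := TangentSpace (𝓡 n) x)).symm).1 hinj
    obtain ⟨v, hv⟩ := hsurj (θ x : TangentSpace (𝓡 n) x →ₗ[ℝ] ℝ)
    exact ⟨v, by ext w; exact LinearMap.congr_fun hv w⟩
  choose V hV using this
  exact ⟨V, hV⟩

/-- The metric pairing is nondegenerate. -/
theorem RiemMetric.eq_of_forall_inner_eq (g : RiemMetric n M) {x : M}
    {v w : TangentSpace (𝓡 n) x} (h : ∀ u, g.inner x v u = g.inner x w u) : v = w := by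
  by_contra hne
  have := g.pos x (v - w) (sub_ne_zero.2 hne)
  simp [h] at this

/-- The differential of a smooth function is a smooth one-form. -/
theorem isSmoothOneForm_mvfderiv {f : M → ℝ} (hf : ContMDiff (𝓡 n) 𝓘(ℝ, ℝ) ∞ f) :
    IsSmoothOneForm (fun x => mvfderiv (𝓡 n) f x) := fun x =>
  contMDiffAt_oneForm_of_forall_apply fun X hX => by
    have h1 : ContMDiff (𝓡 n).tangent 𝓘(ℝ, ℝ).tangent ∞ (tangentMap (𝓡 n) 𝓘(ℝ, ℝ) f) :=
      hf.contMDiff_tangentMap (by simp)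
    exact ((contMDiff_snd_tangentBundle_modelSpace ℝ 𝓘(ℝ, ℝ)).comp h1).contMDiffAt.comp x hX

/-! ### One-forms in charts, the exterior derivative and the Poincaré lemma -/

theorem mvfderiv_eq_fderiv {E : Type*} [NormedAddCommGroup E] [NormedSpace ℝ E] (f : E → ℝ)
    (y : E) : mvfderiv 𝓘(ℝ, E) f y = fderiv ℝ f y := by
  rw [mvfderiv, mfderiv_eq_fderiv]
  rfl

/-- The expression of a one-form in the chart at `p`. -/
noncomputable def oneFormInChart (p : M) (θ : Π x : M, TangentSpace (𝓡 n) x →L[ℝ] ℝ)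
    (y : EuclideanSpace ℝ (Fin n)) : EuclideanSpace ℝ (Fin n) →L[ℝ] ℝ :=
  (θ ((extChartAt (𝓡 n) p).symm y)).comp
    (mfderiv 𝓘(ℝ, EuclideanSpace ℝ (Fin n)) (𝓡 n) (extChartAt (𝓡 n) p).symm y)

theorem contMDiffAt_extChartAt_symm_of_mem {p : M} {y : EuclideanSpace ℝ (Fin n)}
    (hy : y ∈ (extChartAt (𝓡 n) p).target) :
    ContMDiffAt 𝓘(ℝ, EuclideanSpace ℝ (Fin n)) (𝓡 n) ∞ (extChartAt (𝓡 n) p).symm y :=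
  (contMDiffOn_extChartAt_symm p).contMDiffAt ((isOpen_extChartAt_target p).mem_nhds hy)

theorem isInvertible_mfderiv_extChartAt_symm_of_mem {p : M} {y : EuclideanSpace ℝ (Fin n)}
    (hy : y ∈ (extChartAt (𝓡 n) p).target) :
    (mfderiv 𝓘(ℝ, EuclideanSpace ℝ (Fin n)) (𝓡 n) (extChartAt (𝓡 n) p).symm y).IsInvertible := by
  have : IsManifold (𝓡 n) 1 M := .of_le (n := ∞) (by simp)
  have := isInvertible_mfderivWithin_extChartAt_symm (I := 𝓡 n) hy
  rwa [ModelWithCorners.range_eq_univ, mfderivWithin_univ] at this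

/-- Tested on a fixed vector `v`, the local expression is `θ` evaluated on the coordinate field of
`v`, which is the tangent map of the inverse chart applied to a constant field. -/
theorem contDiffAt_oneFormInChart {p : M} {θ : Π x : M, TangentSpace (𝓡 n) x →L[ℝ] ℝ}
    (hθ : IsSmoothOneForm θ) {y : EuclideanSpace ℝ (Fin n)}
    (hy : y ∈ (extChartAt (𝓡 n) p).target) : ContDiffAt ℝ ∞ (oneFormInChart p θ) y := by
  rw [← contMDiffAt_iff_contDiffAt]
  refine contMDiffAt_of_forall_clm_apply fun v => ?_
  have hφ := contMDiffAt_extChartAt_symm_of_mem hy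
  have hopen := isOpen_extChartAt_target (I := 𝓡 n) p
  refine contMDiffAt_oneForm_apply (b := (extChartAt (𝓡 n) p).symm)
    (θ := fun z => θ ((extChartAt (𝓡 n) p).symm z))
    (X := fun z => mfderiv 𝓘(ℝ, EuclideanSpace ℝ (Fin n)) (𝓡 n) (extChartAt (𝓡 n) p).symm z v)
    ((hθ _).comp y hφ) ?_
  have h1 := (contMDiffOn_extChartAt_symm (I := 𝓡 n) (n := ∞) p).contMDiffOn_tangentMapWithin
    (m := ∞) (by simp) hopen.uniqueMDiffOn
  have h2 : ContMDiffAt 𝓘(ℝ, EuclideanSpace ℝ (Fin n)) 𝓘(ℝ, EuclideanSpace ℝ (Fin n)).tangent ∞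
      (fun z => (⟨z, v⟩ : TangentBundle 𝓘(ℝ, EuclideanSpace ℝ (Fin n))
        (EuclideanSpace ℝ (Fin n)))) y :=
    contMDiffAt_vectorSpace_iff_contDiffAt.2 contDiffAt_const
  have hmem : {z | z ∈ (extChartAt (𝓡 n) p).target} ∈ 𝓝 y := hopen.mem_nhds hy
  have h3 := (h1 (⟨y, v⟩ : TangentBundle 𝓘(ℝ, EuclideanSpace ℝ (Fin n))
    (EuclideanSpace ℝ (Fin n))) hy).contMDiffAt
      ((hopen.preimage (FiberBundle.continuous_proj _ _)).mem_nhds hy)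
  refine (h3.comp y h2).congr_of_eventuallyEq ?_
  filter_upwards [hmem] with z hz
  simp only [Function.comp_apply, tangentMapWithin]
  rw [mfderivWithin_of_isOpen hopen hz]

/-- The exterior derivative computed in a chart. -/
theorem extDerivOneForm_extChartAt_symm {p : M} {θ : Π x : M, TangentSpace (𝓡 n) x →L[ℝ] ℝ}
    (hθ : IsSmoothOneForm θ) {X Y : Π x : M, TangentSpace (𝓡 n) x}
    (hX : IsSmoothField X) (hY : IsSmoothField Y) {y : EuclideanSpace ℝ (Fin n)}
    (hy : y ∈ (extChartAt (𝓡 n) p).target) :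
    extDerivOneForm θ X Y ((extChartAt (𝓡 n) p).symm y) =
      fderiv ℝ (oneFormInChart p θ) y
        (VectorField.mpullback 𝓘(ℝ, EuclideanSpace ℝ (Fin n)) (𝓡 n)
          (extChartAt (𝓡 n) p).symm X y)
        (VectorField.mpullback 𝓘(ℝ, EuclideanSpace ℝ (Fin n)) (𝓡 n)
          (extChartAt (𝓡 n) p).symm Y y) -
      fderiv ℝ (oneFormInChart p θ) y
        (VectorField.mpullback 𝓘(ℝ, EuclideanSpace ℝ (Fin n)) (𝓡 n)
          (extChartAt (𝓡 n) p).symm Y y)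
        (VectorField.mpullback 𝓘(ℝ, EuclideanSpace ℝ (Fin n)) (𝓡 n)
          (extChartAt (𝓡 n) p).symm X y) := by
  have : IsManifold (𝓡 n) 1 M := .of_le (n := ∞) (by simp)
  have : IsManifold (𝓡 n) 2 M := .of_le (n := ∞) ENat.LEInfty.out
  have : IsManifold (𝓡 n) (minSmoothness ℝ 2) M := by simpa
  have hopen := isOpen_extChartAt_target (I := 𝓡 n) p
  have hφ := contMDiffAt_extChartAt_symm_of_mem hy
  have hφd := hφ.mdifferentiableAt (by simp)
  have hinv := isInvertible_mfderiv_extChartAt_symm_of_mem hy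
  let pull : (Π x : M, TangentSpace (𝓡 n) x) →
      EuclideanSpace ℝ (Fin n) → EuclideanSpace ℝ (Fin n) := fun Z =>
    VectorField.mpullback 𝓘(ℝ, EuclideanSpace ℝ (Fin n)) (𝓡 n) (extChartAt (𝓡 n) p).symm Z
  have happ : ∀ (Z : Π x : M, TangentSpace (𝓡 n) x), ∀ z ∈ (extChartAt (𝓡 n) p).target,
      mfderiv 𝓘(ℝ, EuclideanSpace ℝ (Fin n)) (𝓡 n) (extChartAt (𝓡 n) p).symm z (pull Z z) =
        Z ((extChartAt (𝓡 n) p).symm z) := by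
    intro Z z hz
    exact (isInvertible_mfderiv_extChartAt_symm_of_mem hz).self_apply_inverse _
  have hpull : ∀ Z : Π x : M, TangentSpace (𝓡 n) x, IsSmoothField Z →
      DifferentiableAt ℝ (pull Z) y := by
    intro Z hZ
    have := ContMDiffAt.mpullback_vectorField_preimage (hZ ((extChartAt (𝓡 n) p).symm y)) hφ hinv
      (m := ∞) (by simp)
    exact (contMDiffAt_vectorSpace_iff_contDiffAt.1 this).differentiableAt (by simp)
  have hθd : DifferentiableAt ℝ (oneFormInChart p θ) y :=
    (contDiffAt_oneFormInChart hθ hy).differentiableAt (by simp)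
  -- Product rule for `θ(Z)` in the chart. In `dθ` the terms that differentiate the fields cancel
  -- against the coordinate bracket `hbr`, leaving the antisymmetrized derivative of the local form.
  have key : ∀ Z W : Π x : M, TangentSpace (𝓡 n) x, IsSmoothField Z →
      mvfderiv (𝓡 n) (fun x => θ x (Z x)) ((extChartAt (𝓡 n) p).symm y)
        (W ((extChartAt (𝓡 n) p).symm y)) =
      fderiv ℝ (oneFormInChart p θ) y (pull W y) (pull Z y) +
        oneFormInChart p θ y (fderiv ℝ (pull Z) y (pull W y)) := by
    intro Z W hZ
    have h1 : MDifferentiableAt (𝓡 n) 𝓘(ℝ, ℝ) (fun x => θ x (Z x))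
        ((extChartAt (𝓡 n) p).symm y) :=
      (contMDiffAt_oneForm_apply (b := fun x => x) (hθ _) (hZ _)).mdifferentiableAt
        (n := ∞) (by simp)
    have h2 := mvfderiv_comp_apply y h1 hφd (pull W y)
    rw [happ W y hy] at h2
    rw [← h2]
    have h3 : (fun x => θ x (Z x)) ∘ (extChartAt (𝓡 n) p).symm =ᶠ[𝓝 y]
        fun z => oneFormInChart p θ z (pull Z z) := by
      filter_upwards [hopen.mem_nhds hy] with z hz
      exact (congrArg (θ ((extChartAt (𝓡 n) p).symm z)) (happ Z z hz)).symm
    have h4 : mvfderiv 𝓘(ℝ, EuclideanSpace ℝ (Fin n))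
        ((fun x => θ x (Z x)) ∘ (extChartAt (𝓡 n) p).symm) y =
        fderiv ℝ ((fun x => θ x (Z x)) ∘ (extChartAt (𝓡 n) p).symm) y := by
      exact mvfderiv_eq_fderiv _ _
    rw [h4, h3.fderiv_eq, fderiv_clm_apply hθd (hpull Z hZ)]
    exact add_comm _ _
  have hbr : θ ((extChartAt (𝓡 n) p).symm y)
      (VectorField.mlieBracket (𝓡 n) X Y ((extChartAt (𝓡 n) p).symm y)) =
      oneFormInChart p θ y (fderiv ℝ (pull Y) y (pull X y) - fderiv ℝ (pull X) y (pull Y y)) := by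
    have h1 := VectorField.mpullback_mlieBracket (hX.isDiffFieldAt _) (hY.isDiffFieldAt _) hφ
      (by simpa using ENat.LEInfty.out)
    have h2 := happ (VectorField.mlieBracket (𝓡 n) X Y) y hy
    rw [← h2]
    change oneFormInChart p θ y _ = _
    congr 1
    refine h1.trans ?_
    have h3 : VectorField.lieBracketWithin ℝ (pull X) (pull Y) univ y =
        fderiv ℝ (pull Y) y (pull X y) - fderiv ℝ (pull X) y (pull Y y) := by
      rw [VectorField.lieBracketWithin_univ]
      rfl
    exact (congrFun VectorField.mlieBracketWithin_univ.symm y).trans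
      ((congrFun VectorField.mlieBracketWithin_eq_lieBracketWithin y).trans h3)
  rw [extDerivOneForm, key Y X hY, key X Y hX, hbr, map_sub]
  change _ + _ - (_ + _) - _ = fderiv ℝ (oneFormInChart p θ) y (pull X y) (pull Y y) -
    fderiv ℝ (oneFormInChart p θ) y (pull Y y) (pull X y)
  ring

/-- The differential of a smooth function is closed. -/
theorem isClosedOneForm_mvfderiv {f : M → ℝ} (hf : ContMDiff (𝓡 n) 𝓘(ℝ, ℝ) ∞ f) :
    IsClosedOneForm (fun x => mvfderiv (𝓡 n) f x) := by
  intro X Y hX hY x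
  have hopen := isOpen_extChartAt_target (I := 𝓡 n) x
  have hx := mem_extChartAt_target (I := 𝓡 n) x
  have key := extDerivOneForm_extChartAt_symm (isSmoothOneForm_mvfderiv hf) hX hY hx
  rw [extChartAt_to_inv] at key
  rw [key, sub_eq_zero]
  -- In the chart `df` becomes an ordinary Fréchet derivative, so closedness is the symmetry of the
  -- second derivative.
  have h1 : ∀ y ∈ (extChartAt (𝓡 n) x).target,
      oneFormInChart x (fun x => mvfderiv (𝓡 n) f x) y =
        fderiv ℝ (f ∘ (extChartAt (𝓡 n) x).symm) y := by
    intro y hy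
    rw [← mvfderiv_eq_fderiv, mvfderiv_comp y ((hf _).mdifferentiableAt (by simp))
      ((contMDiffAt_extChartAt_symm_of_mem hy).mdifferentiableAt (by simp))]
    rfl
  have h2 : oneFormInChart x (fun x => mvfderiv (𝓡 n) f x) =ᶠ[𝓝 (extChartAt (𝓡 n) x x)]
      fderiv ℝ (f ∘ (extChartAt (𝓡 n) x).symm) := by
    filter_upwards [hopen.mem_nhds hx] with y hy using h1 y hy
  rw [h2.fderiv_eq]
  have h3 : ContDiffAt ℝ ∞ (f ∘ (extChartAt (𝓡 n) x).symm) (extChartAt (𝓡 n) x x) :=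
    contMDiffAt_iff_contDiffAt.1 ((hf _).comp _ (contMDiffAt_extChartAt_symm_of_mem hx))
  exact h3.isSymmSndFDerivAt (by simpa using ENat.LEInfty.out) _ _

/-- A closed one-form is locally the differential of a smooth function. -/
theorem IsClosedOneForm.exists_primitive [T2Space M]
    {θ : Π x : M, TangentSpace (𝓡 n) x →L[ℝ] ℝ} (hθ : IsSmoothOneForm θ) (hc : IsClosedOneForm θ)
    (p : M) :
    ∃ U : Set M, IsOpen U ∧ p ∈ U ∧ ∃ f : M → ℝ, ContMDiffOn (𝓡 n) 𝓘(ℝ, ℝ) ∞ f U ∧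
      ∀ x ∈ U, mvfderiv (𝓡 n) f x = θ x := by
  have hM : IsManifold (𝓡 n) 1 M := .of_le (n := ∞) (by simp)
  have hopen := isOpen_extChartAt_target (I := 𝓡 n) p
  obtain ⟨r, hr, hball⟩ := Metric.isOpen_iff.1 hopen _ (mem_extChartAt_target (I := 𝓡 n) p)
  set B := Metric.ball (extChartAt (𝓡 n) p p) r
  have hsm : ∀ y ∈ B, ContDiffAt ℝ ∞ (oneFormInChart p θ) y := fun y hy =>
    contDiffAt_oneFormInChart hθ (hball hy)
  have hsymm : ∀ y ∈ B, ∀ v w, fderiv ℝ (oneFormInChart p θ) y v w =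
      fderiv ℝ (oneFormInChart p θ) y w v := by
    intro y hy v w
    -- Closedness is tested on global smooth fields only; every chart vector at `y` is the pullback
    -- of the value of such a field.
    have hval : ∀ v : EuclideanSpace ℝ (Fin n), ∃ X : Π x : M, TangentSpace (𝓡 n) x,
        IsSmoothField X ∧ VectorField.mpullback 𝓘(ℝ, EuclideanSpace ℝ (Fin n)) (𝓡 n)
          (extChartAt (𝓡 n) p).symm X y = v := by
      intro v
      obtain ⟨X, hX, hXv⟩ := exists_isSmoothField_apply_eq
        (mfderiv 𝓘(ℝ, EuclideanSpace ℝ (Fin n)) (𝓡 n) (extChartAt (𝓡 n) p).symm y v)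
      refine ⟨X, hX, ?_⟩
      rw [VectorField.mpullback_apply, hXv]
      exact (isInvertible_mfderiv_extChartAt_symm_of_mem (hball hy)).inverse_apply_self _
    obtain ⟨X, hX, rfl⟩ := hval v
    obtain ⟨Y, hY, rfl⟩ := hval w
    have := extDerivOneForm_extChartAt_symm hθ hX hY (hball hy)
    rw [hc X Y hX hY] at this
    exact (sub_eq_zero.1 this.symm)
  obtain ⟨F, hF⟩ := (convex_ball _ r).exists_forall_hasFDerivAt_of_fderiv_symmetric
    Metric.isOpen_ball (fun y hy => ((hsm y hy).differentiableAt (by simp)).differentiableWithinAt)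
    hsymm
  have hFsm : ContDiffOn ℝ ∞ F B := by
    rw [contDiffOn_infty_iff_fderiv_of_isOpen Metric.isOpen_ball]
    exact ⟨fun y hy => (hF y hy).differentiableAt.differentiableWithinAt,
      ContDiffOn.congr (fun y hy => (hsm y hy).contDiffWithinAt) fun y hy => (hF y hy).fderiv⟩
  refine ⟨(extChartAt (𝓡 n) p).source ∩ extChartAt (𝓡 n) p ⁻¹' B, ?_, ?_,
    F ∘ extChartAt (𝓡 n) p, ?_, ?_⟩
  · exact isOpen_extChartAt_preimage' p Metric.isOpen_ball
  · exact ⟨mem_extChartAt_source p, Metric.mem_ball_self hr⟩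
  · exact (hFsm.contMDiffOn).comp ((contMDiffOn_extChartAt (I := 𝓡 n) (n := ∞)).mono
      fun y hy => by simpa using hy.1) fun y hy => hy.2
  · rintro x ⟨hx, hxB⟩
    have hd : MDifferentiableAt (𝓡 n) 𝓘(ℝ, EuclideanSpace ℝ (Fin n)) (extChartAt (𝓡 n) p) x :=
      mdifferentiableAt_extChartAt (by simpa using hx)
    have hds := (contMDiffAt_extChartAt_symm_of_mem (hball hxB)).mdifferentiableAt (by simp)
    ext v
    rw [mvfderiv_comp_apply_of_eq x (hF _ hxB).differentiableAt.mdifferentiableAt hd rfl,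
      mvfderiv_eq_fderiv, (hF _ hxB).fderiv]
    have hid : (extChartAt (𝓡 n) p).symm ∘ extChartAt (𝓡 n) p =ᶠ[𝓝 x] id := by
      filter_upwards [(isOpen_extChartAt_source p).mem_nhds hx] with z hz
      exact (extChartAt (𝓡 n) p).left_inv hz
    have h2 : mfderiv (𝓡 n) (𝓡 n) ((extChartAt (𝓡 n) p).symm ∘ extChartAt (𝓡 n) p) x v = v := by
      rw [hid.mfderiv_eq, mfderiv_id]
      rfl
    have h1 := (mfderiv_comp_apply x hds hd v).symm.trans h2
    -- The points `φ⁻¹(φ x)` and `x` are equal only propositionally, so the two tangent vectors lie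
    -- in formally different fibres; this transports `θ` between them.
    have h3 : ∀ (z : M) (u : TangentSpace (𝓡 n) z) (w : TangentSpace (𝓡 n) x), z = x →
        (show EuclideanSpace ℝ (Fin n) from u) = w → θ z u = θ x w := by
      rintro z u w rfl rfl
      rfl
    exact h3 _ _ _ ((extChartAt (𝓡 n) p).left_inv hx) h1

/-! ### Connections and identities for their curvature -/

theorem IsDiffFieldAt.add {X Y : Π x : M, TangentSpace (𝓡 n) x} {x : M}
    (hX : IsDiffFieldAt X x) (hY : IsDiffFieldAt Y x) : IsDiffFieldAt (X + Y) x :=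
  mdifferentiableAt_add_section hX hY

theorem IsDiffFieldAt.smul {X : Π x : M, TangentSpace (𝓡 n) x} {x : M} {f : M → ℝ}
    (hf : MDifferentiableAt (𝓡 n) 𝓘(ℝ, ℝ) f x) (hX : IsDiffFieldAt X x) :
    IsDiffFieldAt (f • X) x :=
  MDifferentiableAt.smul_section hf hX

/-- Every tangent vector is the value of a vector field that is differentiable at its base
point. -/
theorem exists_isDiffFieldAt_apply_eq {x : M} (v : TangentSpace (𝓡 n) x) :
    ∃ X : Π x : M, TangentSpace (𝓡 n) x, IsDiffFieldAt X x ∧ X x = v :=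
  have : IsManifold (𝓡 n) 1 M := .of_le (n := ∞) (by simp)
  ⟨FiberBundle.extend (EuclideanSpace ℝ (Fin n)) v,
    FiberBundle.mdifferentiableAt_extend (𝓡 n) (EuclideanSpace ℝ (Fin n)) v, by simp⟩

/-- A connection takes smooth vector fields to smooth vector fields. -/
theorem AffineConnection.isSmoothField_apply (C : AffineConnection n M)
    {X Z : Π x : M, TangentSpace (𝓡 n) x} (hX : IsSmoothField X) (hZ : IsSmoothField Z) :
    IsSmoothField (fun x => C.toFun Z x (X x)) := by
  have h := C.smooth.contMDiff.contMDiff (σ := Z) (contMDiffOn_univ.2 hZ)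
  exact (contMDiffOn_univ.1 h).clm_bundle_apply hX

open Classical in
/-- The connection `Y ↦ ∇Y + A Y` for a smooth field `A` of endomorphism-valued one-forms. -/
noncomputable def AffineConnection.addTensor (C : AffineConnection n M)
    (A : Π x : M, TangentSpace (𝓡 n) x →ₗ[ℝ] TangentSpace (𝓡 n) x →L[ℝ] TangentSpace (𝓡 n) x)
    (hA : ∀ (X Y : Π x : M, TangentSpace (𝓡 n) x) (x₀ : M),
      ContMDiffAt (𝓡 n) ((𝓡 n).prod 𝓘(ℝ, EuclideanSpace ℝ (Fin n))) ∞
        (fun x => (⟨x, X x⟩ : TangentBundle (𝓡 n) M)) x₀ →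
      ContMDiffAt (𝓡 n) ((𝓡 n).prod 𝓘(ℝ, EuclideanSpace ℝ (Fin n))) ∞
        (fun x => (⟨x, Y x⟩ : TangentBundle (𝓡 n) M)) x₀ →
      ContMDiffAt (𝓡 n) ((𝓡 n).prod 𝓘(ℝ, EuclideanSpace ℝ (Fin n))) ∞
        (fun x => (⟨x, A x (Y x) (X x)⟩ : TangentBundle (𝓡 n) M)) x₀) :
    AffineConnection n M where
  -- The value zero at non-differentiable fields is the one that `junk` prescribes.
  toFun Y x := if IsDiffFieldAt Y x then C.toFun Y x + A x (Y x) else 0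
  isCovariantDerivativeOnUniv :=
    { add := fun {σ σ' x} hσ hσ' hx => by
        have h1 : IsDiffFieldAt σ x := hσ
        have h2 : IsDiffFieldAt σ' x := hσ'
        rw [if_pos h1, if_pos h2, if_pos (h1.add h2), C.isCovariantDerivativeOnUniv.add hσ hσ',
          Pi.add_apply, map_add]
        abel
      leibniz := fun {σ g x} hσ hg hx => by
        have h1 : IsDiffFieldAt σ x := hσ
        rw [if_pos h1, if_pos (h1.smul hg), C.isCovariantDerivativeOnUniv.leibniz hσ hg,
          Pi.smul_apply', map_smul]
        module }
  smooth := ⟨⟨fun {σ} hσ => by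
    have hσ' : IsSmoothField σ := contMDiffOn_univ.1 hσ
    have h1 := contMDiffOn_univ.1 (C.smooth.contMDiff.contMDiff hσ)
    have h2 : ContMDiff (𝓡 n) ((𝓡 n).prod 𝓘(ℝ, EuclideanSpace ℝ (Fin n) →L[ℝ]
        EuclideanSpace ℝ (Fin n))) ∞ (fun x => TotalSpace.mk'
          (EuclideanSpace ℝ (Fin n) →L[ℝ] EuclideanSpace ℝ (Fin n))
          (E := fun x : M => TangentSpace (𝓡 n) x →L[ℝ] TangentSpace (𝓡 n) x) x (A x (σ x))) :=
      fun x => contMDiffAt_hom_section_of_forall_apply fun X hX => hA X σ x hX (hσ' x)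
    have h3 := h1.add_section h2
    refine contMDiffOn_univ.2 ?_
    convert h3 using 3 with x
    exact if_pos (hσ'.isDiffFieldAt x)⟩⟩
  junk Y x h := if_neg h

theorem AffineConnection.addTensor_apply (C : AffineConnection n M)
    {A : Π x : M, TangentSpace (𝓡 n) x →ₗ[ℝ] TangentSpace (𝓡 n) x →L[ℝ] TangentSpace (𝓡 n) x}
    (hA) {Y : Π x : M, TangentSpace (𝓡 n) x} {x : M} (hY : IsDiffFieldAt Y x) :
    (C.addTensor A hA).toFun Y x = C.toFun Y x + A x (Y x) :=
  if_pos hY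

/-- The first Bianchi identity. -/
theorem curvature_add_cyclic (D : AffineConnection n M) (hD : IsTorsionFreeOn D.toFun univ)
    {X Y Z : Π x : M, TangentSpace (𝓡 n) x} (hX : IsSmoothField X) (hY : IsSmoothField Y)
    (hZ : IsSmoothField Z) (x : M) :
    curvature D.toFun X Y Z x + curvature D.toFun Y Z X x + curvature D.toFun Z X Y x = 0 := by
  have hM : IsManifold (𝓡 n) (minSmoothness ℝ 2) M :=
    .of_le (n := ∞) (by simpa using ENat.LEInfty.out)
  have hM : IsManifold (𝓡 n) (minSmoothness ℝ 3) M :=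
    .of_le (n := ∞) (by simpa using ENat.LEInfty.out)
  have hM : IsManifold (𝓡 n) (((⊤ : ℕ∞) : ℕ∞ω) + 1) M := .of_le (n := ∞) (by simp)
  have hbr : ∀ {U W : Π x : M, TangentSpace (𝓡 n) x}, IsSmoothField U → IsSmoothField W →
      IsSmoothField (VectorField.mlieBracket (𝓡 n) U W) := fun hU hW =>
    ContDiff.mlieBracket_vectorField (m := ⊤) (n := ⊤) hU hW (by simp)
  have hsub : ∀ {U W : Π x : M, TangentSpace (𝓡 n) x} {x : M}, IsDiffFieldAt U x →
      IsDiffFieldAt W x → D.toFun (U - W) x = D.toFun U x - D.toFun W x := by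
    intro U W x hU hW
    have h := D.isCovariantDerivativeOnUniv.add (σ := U - W) (σ' := W) (x := x)
      (mdifferentiableAt_sub_section hU hW) hW
    rw [sub_add_cancel] at h
    rw [h, add_sub_cancel_right]
  -- Torsion-freeness, used twice: `D_U W - D_W U = [U, W]` and `D_T [U, W] = D_{[U, W]} T + [T, [U,
  -- W]]`. In the cyclic sum the terms `D_{[U, W]} T` cancel against the last terms of the
  -- curvatures, and the double brackets vanish by Jacobi.
  have key : ∀ {U W T : Π x : M, TangentSpace (𝓡 n) x}, IsSmoothField U → IsSmoothField W →
      IsSmoothField T →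
      D.toFun (fun y => D.toFun W y (U y)) x (T x) - D.toFun (fun y => D.toFun U y (W y)) x (T x)
        = D.toFun T x (VectorField.mlieBracket (𝓡 n) U W x)
          + VectorField.mlieBracket (𝓡 n) T (VectorField.mlieBracket (𝓡 n) U W) x := by
    intro U W T hU hW hT
    have h1 : (fun y => D.toFun W y (U y)) - (fun y => D.toFun U y (W y)) =
        VectorField.mlieBracket (𝓡 n) U W := by
      funext y
      exact hD U W y (mem_univ y) (hU.isDiffFieldAt y) (hW.isDiffFieldAt y)
    have h2 := hsub ((D.isSmoothField_apply hU hW).isDiffFieldAt x)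
      ((D.isSmoothField_apply hW hU).isDiffFieldAt x)
    rw [h1] at h2
    have h3 := hD T (VectorField.mlieBracket (𝓡 n) U W) x (mem_univ x) (hT.isDiffFieldAt x)
      ((hbr hU hW).isDiffFieldAt x)
    rw [← h3, h2]
    simp
  have h2 : ∀ {U : Π x : M, TangentSpace (𝓡 n) x}, IsSmoothField U →
      ContMDiffAt (𝓡 n) (𝓡 n).tangent (minSmoothness ℝ 2)
        (fun x => (⟨x, U x⟩ : TangentBundle (𝓡 n) M)) x := fun hU =>
    (hU x).of_le (by simpa using ENat.LEInfty.out)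
  have jac := VectorField.leibniz_identity_mlieBracket_apply (h2 hX) (h2 hY) (h2 hZ)
  -- Antisymmetry brings the Leibniz form of the Jacobi identity towards its cyclic form.
  rw [VectorField.mlieBracket_swap_apply (V := VectorField.mlieBracket (𝓡 n) X Y),
    VectorField.mlieBracket_swap (V := X) (W := Z)] at jac
  have hneg : VectorField.mlieBracket (𝓡 n) Y (-VectorField.mlieBracket (𝓡 n) Z X) x =
      -VectorField.mlieBracket (𝓡 n) Y (VectorField.mlieBracket (𝓡 n) Z X) x := by
    have := VectorField.mlieBracket_const_smul_right (I := 𝓡 n) (V := Y) (c := (-1 : ℝ))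
      ((hbr hZ hX).isDiffFieldAt x)
    simpa using this
  rw [hneg] at jac
  have k1 := key hY hZ hX
  have k2 := key hZ hX hY
  have k3 := key hX hY hZ
  have : curvature D.toFun X Y Z x + curvature D.toFun Y Z X x + curvature D.toFun Z X Y x =
      (D.toFun (fun y => D.toFun Z y (Y y)) x (X x) - D.toFun (fun y => D.toFun Y y (Z y)) x (X x))
      + (D.toFun (fun y => D.toFun X y (Z y)) x (Y x) - D.toFun (fun y => D.toFun Z y (X y)) x (Y x))
      + (D.toFun (fun y => D.toFun Y y (X y)) x (Z x) - D.toFun (fun y => D.toFun X y (Y y)) x (Z x))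
      - D.toFun Z x (VectorField.mlieBracket (𝓡 n) X Y x)
      - D.toFun X x (VectorField.mlieBracket (𝓡 n) Y Z x)
      - D.toFun Y x (VectorField.mlieBracket (𝓡 n) Z X x) := by
    simp only [curvature]
    abel
  rw [this, k1, k2, k3, jac]
  abel

/-- The curvature of `D = ∇ - θ ⊗ Id`. -/
theorem curvature_sub_oneForm {C D : AffineConnection n M}
    {θ : Π x : M, TangentSpace (𝓡 n) x →L[ℝ] ℝ} (hθ : IsSmoothOneForm θ)
    (hCD : ∀ (Y : Π x : M, TangentSpace (𝓡 n) x) (x : M), IsDiffFieldAt Y x →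
      ∀ u : TangentSpace (𝓡 n) x, D.toFun Y x u = C.toFun Y x u - θ x u • Y x)
    {X Y Z : Π x : M, TangentSpace (𝓡 n) x} (hX : IsSmoothField X) (hY : IsSmoothField Y)
    (hZ : IsSmoothField Z) (x : M) :
    curvature D.toFun X Y Z x = curvature C.toFun X Y Z x - extDerivOneForm θ X Y x • Z x := by
  have hθd : ∀ {U : Π x : M, TangentSpace (𝓡 n) x}, IsSmoothField U →
      MDifferentiableAt (𝓡 n) 𝓘(ℝ, ℝ) (fun y => -θ y (U y)) x := fun hU =>
    ((contMDiffAt_oneForm_apply (b := fun x => x) (hθ x) (hU x)).mdifferentiableAt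
      (n := ∞) (by simp)).neg
  -- On antisymmetrizing in `U, W`, the two mixed terms `θ(U) C_W Z + θ(W) C_U Z` and the term `θ(W)
  -- θ(U) Z` drop out; only derivatives of `θ` survive.
  have key : ∀ {U W : Π x : M, TangentSpace (𝓡 n) x}, IsSmoothField U → IsSmoothField W →
      D.toFun (fun y => D.toFun Z y (U y)) x (W x) =
        C.toFun (fun y => C.toFun Z y (U y)) x (W x) - θ x (U x) • C.toFun Z x (W x)
          - mvfderiv (𝓡 n) (fun y => θ y (U y)) x (W x) • Z x
          - θ x (W x) • C.toFun Z x (U x) + (θ x (W x) * θ x (U x)) • Z x := by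
    intro U W hU hW
    have h1 : (fun y => D.toFun Z y (U y)) =
        (fun y => C.toFun Z y (U y)) + (fun y => -θ y (U y)) • Z := by
      funext y
      rw [hCD Z y (hZ.isDiffFieldAt y), Pi.add_apply, Pi.smul_apply', neg_smul, sub_eq_add_neg]
    have h2 := (C.isSmoothField_apply hU hZ).isDiffFieldAt x
    have h3 : IsDiffFieldAt ((fun y => -θ y (U y)) • Z) x := (hZ.isDiffFieldAt x).smul (hθd hU)
    have h4 : mvfderiv (𝓡 n) (fun y => -θ y (U y)) x = -mvfderiv (𝓡 n) (fun y => θ y (U y)) x :=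
      mvfderiv_neg
    rw [h1, hCD _ x (h2.add h3), C.isCovariantDerivativeOnUniv.add h2 h3,
      C.isCovariantDerivativeOnUniv.leibniz (hZ.isDiffFieldAt x) (hθd hU), h4]
    simp
    module
  rw [curvature, key hY hX, key hX hY, hCD Z x (hZ.isDiffFieldAt x), curvature, extDerivOneForm]
  module

end VectorialTorsion

/-! ### The flatness criterion and uniqueness of the defining data -/

namespace VectorialTorsion

theorem finrank_tangentSpace {n : ℕ} {M : Type*} [TopologicalSpace M]
    [ChartedSpace (EuclideanSpace ℝ (Fin n)) M] (x : M) :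
    Module.finrank ℝ (TangentSpace (𝓡 n) x) = n :=
  finrank_euclideanSpace_fin (𝕜 := ℝ) (n := n)

variable {n : ℕ} {M : Type*} [TopologicalSpace M]
  [ChartedSpace (EuclideanSpace ℝ (Fin n)) M] [IsManifold (𝓡 n) ∞ M]

/-- For a torsion-free connection `D = ∇ - θ ⊗ Id`, flatness of `∇` amounts to closedness of `θ`
and flatness of `D`. -/
theorem isFlat_iff_of_sub_oneForm [T2Space M] (hn : 3 ≤ n) {C D : AffineConnection n M}
    {θ : Π x : M, TangentSpace (𝓡 n) x →L[ℝ] ℝ} (hθ : IsSmoothOneForm θ)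
    (hCD : ∀ (Y : Π x : M, TangentSpace (𝓡 n) x) (x : M), IsDiffFieldAt Y x →
      ∀ u : TangentSpace (𝓡 n) x, D.toFun Y x u = C.toFun Y x u - θ x u • Y x)
    (hD : IsTorsionFreeOn D.toFun univ) : C.IsFlat ↔ IsClosedOneForm θ ∧ D.IsFlat := by
  constructor
  · intro hC
    have hcl : IsClosedOneForm θ := by
      intro X Y hX hY x
      -- This is where `3 ≤ n` enters: two vectors cannot span the tangent space. `X x` and `Y x`
      -- may be dependent.
      have hlt : Submodule.span ℝ {X x, Y x} ≠ ⊤ := by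
        intro htop
        classical
        have h1 := finrank_span_finset_le_card (R := ℝ)
          ({X x, Y x} : Finset (TangentSpace (𝓡 n) x))
        rw [Set.finrank, Finset.coe_pair, htop, finrank_top, finrank_tangentSpace] at h1
        have h2 := Finset.card_le_two (a := X x) (b := Y x)
        omega
      obtain ⟨z, -, hz⟩ := SetLike.exists_of_lt (lt_top_iff_ne_top.2 hlt)
      obtain ⟨Z, hZ, rfl⟩ := exists_isSmoothField_apply_eq z
      -- As `C` is flat, the Bianchi identity for `D` is a linear relation among `X, Y, Z` with
      -- coefficient `-dθ(X, Y)` at `Z`; were it nonzero, `Z` would lie in the span of `X` and `Y`.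
      have hb := curvature_add_cyclic D hD hX hY hZ x
      rw [curvature_sub_oneForm hθ hCD hX hY hZ, curvature_sub_oneForm hθ hCD hY hZ hX,
        curvature_sub_oneForm hθ hCD hZ hX hY, hC X Y Z hX hY hZ x (mem_univ x),
        hC Y Z X hY hZ hX x (mem_univ x), hC Z X Y hZ hX hY x (mem_univ x)] at hb
      by_contra hne
      refine hz (Submodule.mem_span_pair.2
        ⟨-(extDerivOneForm θ X Y x)⁻¹ * extDerivOneForm θ Y Z x,
          -(extDerivOneForm θ X Y x)⁻¹ * extDerivOneForm θ Z X x, ?_⟩)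
      have h3 : extDerivOneForm θ X Y x • Z x =
          -(extDerivOneForm θ Y Z x • X x) - extDerivOneForm θ Z X x • Y x := by
        rw [← sub_eq_zero, ← neg_eq_zero, ← hb]
        module
      have h4 : Z x = (extDerivOneForm θ X Y x)⁻¹ • (extDerivOneForm θ X Y x • Z x) := by
        rw [smul_smul, inv_mul_cancel₀ hne, one_smul]
      rw [h4, h3]
      module
    refine ⟨hcl, fun X Y Z hX hY hZ x hx => ?_⟩
    rw [curvature_sub_oneForm hθ hCD hX hY hZ, hC X Y Z hX hY hZ x hx, hcl X Y hX hY x]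
    simp
  · rintro ⟨hcl, hDf⟩ X Y Z hX hY hZ x hx
    have h := curvature_sub_oneForm hθ hCD hX hY hZ x
    rw [hDf X Y Z hX hY hZ x hx, hcl X Y hX hY x] at h
    simpa using h.symm

/-- The Levi-Civita connection is unique. -/
theorem IsLeviCivita.apply_eq {g : RiemMetric n M} {L L' : AffineConnection n M}
    (hL : IsLeviCivita g L) (hL' : IsLeviCivita g L') {Y : Π x : M, TangentSpace (𝓡 n) x} {x : M}
    (hY : IsDiffFieldAt Y x) : L.toFun Y x = L'.toFun Y x := by
  have hM : IsManifold (𝓡 n) 1 M := .of_le (n := ∞) (by simp)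
  let S := L.isCovariantDerivativeOnUniv.difference L'.isCovariantDerivativeOnUniv x
  have hS : ∀ {Y : Π x : M, TangentSpace (𝓡 n) x}, IsDiffFieldAt Y x →
      S (Y x) = L.toFun Y x - L'.toFun Y x := fun hY =>
    IsCovariantDerivativeOn.difference_apply _ _ (mem_univ x) hY
  have hsymm : ∀ u v, S u v = S v u := by
    intro u v
    obtain ⟨U, hU, rfl⟩ := exists_isDiffFieldAt_apply_eq u
    obtain ⟨V, hV, rfl⟩ := exists_isDiffFieldAt_apply_eq v
    have h1 := hL.torsionFree U V x (mem_univ x) hU hV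
    have h2 := hL'.torsionFree U V x (mem_univ x) hU hV
    rw [hS hU, hS hV]
    have h3 := h1.trans h2.symm
    rw [sub_apply, sub_apply]
    rw [sub_eq_sub_iff_add_eq_add] at h3 ⊢
    rw [h3, add_comm]
  have hskew : ∀ u v w, g.inner x (S v u) w + g.inner x v (S w u) = 0 := by
    intro u v w
    obtain ⟨V, hV, rfl⟩ := exists_isDiffFieldAt_apply_eq v
    obtain ⟨W, hW, rfl⟩ := exists_isDiffFieldAt_apply_eq w
    have h1 := hL.metric V W x (mem_univ x) hV hW u
    have h2 := hL'.metric V W x (mem_univ x) hV hW u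
    rw [derivForm] at h1 h2
    rw [hS hV, hS hW]
    simp only [sub_apply, map_sub]
    linarith
  -- The trilinear form `g(S u v, w)` is symmetric in `u, v` and skew in `v, w`, hence zero: combine
  -- three cyclic instances.
  have hzero : ∀ u v w, g.inner x (S u v) w = 0 := by
    intro u v w
    have h1 := hskew u v w
    have h2 := hskew w u v
    have h3 := hskew v w u
    rw [g.symm x v, hsymm v u, hsymm w u] at h1
    rw [g.symm x u] at h2
    rw [g.symm x w, hsymm w v] at h3
    linarith
  have h0 : S (Y x) = 0 := by
    ext1 v
    exact g.eq_of_forall_inner_eq fun w => by simp [hzero]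
  exact sub_eq_zero.1 ((hS hY).symm.trans h0)

/-- A metric connection with vectorial torsion determines its vector field. -/
theorem IsVectorialConnection.field_eq (hn : 2 ≤ n) {g : RiemMetric n M}
    {V V' : Π x : M, TangentSpace (𝓡 n) x} {C : AffineConnection n M}
    (h : IsVectorialConnection g V C) (h' : IsVectorialConnection g V' C) : V = V' := by
  obtain ⟨-, L, hL, hC⟩ := h
  obtain ⟨-, L', hL', hC'⟩ := h'
  funext x
  by_contra hne
  set w := V x - V' x with hw
  have hw0 : w ≠ 0 := sub_ne_zero.2 hne
  have key : ∀ u v : TangentSpace (𝓡 n) x, g.inner x u v • w = g.inner x w v • u := by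
    intro u v
    obtain ⟨Y, hY, rfl⟩ := exists_isDiffFieldAt_apply_eq v
    have h1 := hC Y x hY u
    rw [hC' Y x hY u, hL.apply_eq hL' hY] at h1
    rw [hw, map_sub, sub_apply, smul_sub, sub_smul, ← sub_eq_zero]
    rw [← sub_eq_zero] at h1
    rw [← neg_eq_zero, ← h1]
    abel
  have hpos := g.pos x w hw0
  -- Taking `v = w` in `key` makes every `u` a multiple of `w`, so the tangent space would be a
  -- line.
  have htop : Submodule.span ℝ {w} = ⊤ := by
    refine eq_top_iff.2 fun u _ => Submodule.mem_span_singleton.2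
      ⟨(g.inner x w w)⁻¹ * g.inner x u w, ?_⟩
    rw [mul_smul, key u w, smul_smul, inv_mul_cancel₀ hpos.ne', one_smul]
  have h1 := finrank_span_singleton (K := ℝ) hw0
  rw [htop, finrank_top, finrank_tangentSpace] at h1
  omega

/-- The Weyl connection and the metric connection with vectorial torsion of `(g, V)` differ by
`V^♭ ⊗ Id`. -/
theorem IsWeylConnection.apply_eq {g : RiemMetric n M} {V : Π x : M, TangentSpace (𝓡 n) x}
    {C D : AffineConnection n M} (hC : IsVectorialConnection g V C) (hD : IsWeylConnection g V D)
    (Y : Π x : M, TangentSpace (𝓡 n) x) (x : M) (hY : IsDiffFieldAt Y x)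
    (u : TangentSpace (𝓡 n) x) :
    D.toFun Y x u = C.toFun Y x u - g.inner x (V x) u • Y x := by
  obtain ⟨-, L, hL, hC⟩ := hC
  obtain ⟨-, L', hL', hD⟩ := hD
  rw [hC Y x hY, hD Y x hY, hL.apply_eq hL' hY, g.symm x (V x) u, g.symm x (V x) (Y x)]
  abel

/-! ### Weyl connections and Lee forms -/

/-- The tensor added to `∇^g` is symmetric in its two arguments, so the torsion does not change. -/
theorem IsWeylConnection.isTorsionFreeOn {g : RiemMetric n M}
    {V : Π x : M, TangentSpace (𝓡 n) x} {D : AffineConnection n M} (hD : IsWeylConnection g V D) :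
    IsTorsionFreeOn D.toFun univ := by
  obtain ⟨-, L, hL, hD⟩ := hD
  intro X Y x hx hX hY
  rw [hD Y x hY, hD X x hX, ← hL.torsionFree X Y x hx hX hY, g.symm x (Y x) (X x)]
  abel

/-- The Lee form of the Weyl connection of `(g, V)` with respect to `g` is `-V^♭`. -/
theorem IsWeylConnection.isLeeForm {g : RiemMetric n M} {V : Π x : M, TangentSpace (𝓡 n) x}
    {D : AffineConnection n M} (hD : IsWeylConnection g V D) :
    IsLeeForm g D (fun x => -g.inner x (V x)) := by
  obtain ⟨hV, L, hL, hD⟩ := hD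
  refine ⟨fun x => (g.isSmoothOneForm_flat hV x).neg_section, fun Y Z x hY hZ u => ?_⟩
  have h := hL.metric Y Z x (mem_univ x) hY hZ u
  rw [derivForm] at h ⊢
  rw [hD Y x hY, hD Z x hZ]
  simp only [map_add, map_sub, map_smul, add_apply,
    sub_apply, smul_apply, smul_eq_mul,
    neg_apply]
  have e1 := g.symm x (Y x) u
  have e2 := g.symm x (V x) u
  have e3 := g.symm x (V x) (Z x)
  rw [e1, e2, e3]
  linear_combination h

/-- The covariant derivative of a conformally rescaled metric. -/
theorem derivForm_exp_smul (g : RiemMetric n M) (C : ConnOperator n M) {f : M → ℝ} {x : M}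
    (hf : MDifferentiableAt (𝓡 n) 𝓘(ℝ, ℝ) f x) {Y Z : Π x : M, TangentSpace (𝓡 n) x}
    (hY : IsDiffFieldAt Y x) (hZ : IsDiffFieldAt Z x) (u : TangentSpace (𝓡 n) x) :
    derivForm (fun x => Real.exp (2 * f x) • g.inner x) C Y Z x u =
      Real.exp (2 * f x) * (2 * mvfderiv (𝓡 n) f x u * g.inner x (Y x) (Z x) +
        derivForm g.inner C Y Z x u) := by
  have hexp : HasDerivAt (fun t : ℝ => Real.exp (2 * t)) (Real.exp (2 * f x) * 2) (f x) := by
    simpa using ((hasDerivAt_id (f x)).const_mul 2).exp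
  have hed : MDifferentiableAt 𝓘(ℝ, ℝ) 𝓘(ℝ, ℝ) (fun t : ℝ => Real.exp (2 * t)) (f x) :=
    hexp.differentiableAt.mdifferentiableAt
  have h1 : mvfderiv (𝓡 n) (fun y => Real.exp (2 * f y)) x u =
      Real.exp (2 * f x) * 2 * mvfderiv (𝓡 n) f x u := by
    have h := mvfderiv_comp_apply x hed hf u
    rw [mvfderiv_eq_fderiv, hexp.hasFDerivAt.fderiv] at h
    exact h.trans (mul_comm _ _)
  have h2 := mvfderiv_mul (I := 𝓡 n) (hed.comp x hf) (g.mdifferentiableAt_inner hY hZ)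
  have h3 : (fun y => (Real.exp (2 * f y) • g.inner y) (Y y) (Z y)) =
      ((fun t : ℝ => Real.exp (2 * t)) ∘ f) * fun y => g.inner y (Y y) (Z y) := rfl
  have h1' : mvfderiv (𝓡 n) ((fun t : ℝ => Real.exp (2 * t)) ∘ f) x u =
      Real.exp (2 * f x) * 2 * mvfderiv (𝓡 n) f x u := h1
  rw [derivForm, derivForm, h3, h2]
  simp only [add_apply, smul_apply, smul_eq_mul, Function.comp_apply, h1']
  ring

/-- The Lee forms of conformal metrics differ by the differential of the conformal factor. -/
theorem IsLeeForm.conformal {g g' : RiemMetric n M} {D : AffineConnection n M}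
    {θ : Π x : M, TangentSpace (𝓡 n) x →L[ℝ] ℝ} (hθ : IsLeeForm g D θ) {f : M → ℝ}
    (hf : ContMDiff (𝓡 n) 𝓘(ℝ, ℝ) ∞ f)
    (hg : ∀ (x : M) (v w : TangentSpace (𝓡 n) x),
      g'.inner x v w = Real.exp (2 * f x) * g.inner x v w) :
    IsLeeForm g' D (fun x => θ x - mvfderiv (𝓡 n) f x) := by
  refine ⟨fun x => (hθ.1 x).sub_section (isSmoothOneForm_mvfderiv hf x), fun Y Z x hY hZ u => ?_⟩
  have hinner : g'.inner = fun x => Real.exp (2 * f x) • g.inner x := by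
    funext x
    ext v w
    exact hg x v w
  rw [hinner, derivForm_exp_smul g D.toFun ((hf x).mdifferentiableAt (by simp)) hY hZ u,
    hθ.2 Y Z x hY hZ u]
  simp only [sub_apply, smul_apply, smul_eq_mul]
  ring

/-- The Lee form is determined by the metric and the connection. -/
theorem IsLeeForm.eq {g : RiemMetric n M} {D : AffineConnection n M}
    {θ θ' : Π x : M, TangentSpace (𝓡 n) x →L[ℝ] ℝ} (hθ : IsLeeForm g D θ)
    (hθ' : IsLeeForm g D θ') : θ = θ' := by
  funext x
  ext u
  by_cases hu : u = 0
  · simp [hu]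
  -- Both Lee forms are tested on the pair `(u, u)`, where `g(u, u) ≠ 0` cancels.
  · obtain ⟨Y, hY, rfl⟩ := exists_isDiffFieldAt_apply_eq u
    have h := (hθ.2 Y Y x hY hY (Y x)).symm.trans (hθ'.2 Y Y x hY hY (Y x))
    have := mul_right_cancel₀ (g.pos x _ hu).ne' h
    linarith

theorem extDerivOneForm_sub {θ η : Π x : M, TangentSpace (𝓡 n) x →L[ℝ] ℝ}
    (hθ : IsSmoothOneForm θ) (hη : IsSmoothOneForm η) {X Y : Π x : M, TangentSpace (𝓡 n) x}
    (hX : IsSmoothField X) (hY : IsSmoothField Y) (x : M) :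
    extDerivOneForm (fun x => θ x - η x) X Y x =
      extDerivOneForm θ X Y x - extDerivOneForm η X Y x := by
  have hd : ∀ {ζ : Π x : M, TangentSpace (𝓡 n) x →L[ℝ] ℝ} {Z : Π x : M, TangentSpace (𝓡 n) x},
      IsSmoothOneForm ζ → IsSmoothField Z →
      MDifferentiableAt (𝓡 n) 𝓘(ℝ, ℝ) (fun y => ζ y (Z y)) x := fun hζ hZ =>
    (contMDiffAt_oneForm_apply (b := fun x => x) (hζ x) (hZ x)).mdifferentiableAt (n := ∞) (by simp)
  have h : ∀ {Z : Π x : M, TangentSpace (𝓡 n) x}, IsSmoothField Z →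
      mvfderiv (𝓡 n) (fun y => (θ y - η y) (Z y)) x =
        mvfderiv (𝓡 n) (fun y => θ y (Z y)) x - mvfderiv (𝓡 n) (fun y => η y (Z y)) x := fun hZ =>
    mvfderiv_sub (hd hθ hZ) (hd hη hZ)
  rw [extDerivOneForm, extDerivOneForm, extDerivOneForm, h hX, h hY]
  simp only [sub_apply]
  ring

theorem isSmoothOneForm_zero : IsSmoothOneForm (fun x : M => (0 : TangentSpace (𝓡 n) x →L[ℝ] ℝ)) :=
  fun _ => contMDiffAt_oneForm_of_forall_apply fun _ _ => contMDiffAt_const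

theorem IsClosedOneForm.sub {θ η : Π x : M, TangentSpace (𝓡 n) x →L[ℝ] ℝ}
    (hθ : IsSmoothOneForm θ) (hη : IsSmoothOneForm η) (hcθ : IsClosedOneForm θ)
    (hcη : IsClosedOneForm η) : IsClosedOneForm (fun x => θ x - η x) := fun X Y hX hY x => by
  rw [extDerivOneForm_sub hθ hη hX hY, hcθ X Y hX hY, hcη X Y hX hY, sub_zero]

theorem IsClosedOneForm.neg {θ : Π x : M, TangentSpace (𝓡 n) x →L[ℝ] ℝ}
    (hθ : IsSmoothOneForm θ) (hcθ : IsClosedOneForm θ) : IsClosedOneForm (fun x => -θ x) := by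
  have h0 : IsClosedOneForm (fun x : M => (0 : TangentSpace (𝓡 n) x →L[ℝ] ℝ)) := by
    intro X Y hX hY x
    -- The zero form is treated as `θ - θ`.
    simpa using extDerivOneForm_sub hθ hθ hX hY x
  simpa using IsClosedOneForm.sub isSmoothOneForm_zero hθ h0 hcθ

/-- The endomorphism-valued one-form `θ ⊗ Id`. -/
noncomputable def oneFormTensorId (θ : Π x : M, TangentSpace (𝓡 n) x →L[ℝ] ℝ) (x : M) :
    TangentSpace (𝓡 n) x →ₗ[ℝ] TangentSpace (𝓡 n) x →L[ℝ] TangentSpace (𝓡 n) x where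
  toFun v := (θ x).smulRight v
  map_add' v w := by ext1 u; simp
  map_smul' c v := by ext1 u; simp [smul_comm c]

/-- The connection `∇ + θ ⊗ Id`. -/
theorem AffineConnection.exists_add_oneForm (C : AffineConnection n M)
    {θ : Π x : M, TangentSpace (𝓡 n) x →L[ℝ] ℝ} (hθ : IsSmoothOneForm θ) :
    ∃ D : AffineConnection n M, ∀ (Y : Π x : M, TangentSpace (𝓡 n) x) (x : M),
      IsDiffFieldAt Y x → ∀ u : TangentSpace (𝓡 n) x,
        D.toFun Y x u = C.toFun Y x u + θ x u • Y x := by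
  have hA : ∀ (X Y : Π x : M, TangentSpace (𝓡 n) x) (x₀ : M),
      ContMDiffAt (𝓡 n) ((𝓡 n).prod 𝓘(ℝ, EuclideanSpace ℝ (Fin n))) ∞
        (fun x => (⟨x, X x⟩ : TangentBundle (𝓡 n) M)) x₀ →
      ContMDiffAt (𝓡 n) ((𝓡 n).prod 𝓘(ℝ, EuclideanSpace ℝ (Fin n))) ∞
        (fun x => (⟨x, Y x⟩ : TangentBundle (𝓡 n) M)) x₀ →
      ContMDiffAt (𝓡 n) ((𝓡 n).prod 𝓘(ℝ, EuclideanSpace ℝ (Fin n))) ∞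
        (fun x => (⟨x, oneFormTensorId θ x (Y x) (X x)⟩ : TangentBundle (𝓡 n) M)) x₀ :=
    fun X Y x₀ hX hY =>
      ContMDiffAt.smul_section (contMDiffAt_oneForm_apply (b := fun x => x) (hθ x₀) hX) hY
  exact ⟨C.addTensor (oneFormTensorId θ) hA, fun Y x hY u =>
    congrArg (fun T => T u) (C.addTensor_apply hA hY)⟩

/-- The difference of the Levi-Civita connection and the Weyl connection of `(g, V)`. -/
noncomputable def weylTensor (g : RiemMetric n M) (V : Π x : M, TangentSpace (𝓡 n) x) (x : M) :
    TangentSpace (𝓡 n) x →ₗ[ℝ] TangentSpace (𝓡 n) x →L[ℝ] TangentSpace (𝓡 n) x where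
  toFun v := (g.inner x (V x)).smulRight v + g.inner x v (V x) • ContinuousLinearMap.id ℝ _ -
    (g.inner x v).smulRight (V x)
  map_add' v w := by ext1 u; simp; module
  map_smul' c v := by ext1 u; simp; module

/-- A torsion-free connection with Lee form `-V^♭` with respect to `g` is the Weyl connection of
`(g, V)`. -/
theorem IsWeylConnection.of_isLeeForm {g : RiemMetric n M} {V : Π x : M, TangentSpace (𝓡 n) x}
    (hV : IsSmoothField V) {D : AffineConnection n M} (hD : IsTorsionFreeOn D.toFun univ)
    (hθ : IsLeeForm g D (fun x => -g.inner x (V x))) : IsWeylConnection g V D := by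
  have hA : ∀ (X Y : Π x : M, TangentSpace (𝓡 n) x) (x₀ : M),
      ContMDiffAt (𝓡 n) ((𝓡 n).prod 𝓘(ℝ, EuclideanSpace ℝ (Fin n))) ∞
        (fun x => (⟨x, X x⟩ : TangentBundle (𝓡 n) M)) x₀ →
      ContMDiffAt (𝓡 n) ((𝓡 n).prod 𝓘(ℝ, EuclideanSpace ℝ (Fin n))) ∞
        (fun x => (⟨x, Y x⟩ : TangentBundle (𝓡 n) M)) x₀ →
      ContMDiffAt (𝓡 n) ((𝓡 n).prod 𝓘(ℝ, EuclideanSpace ℝ (Fin n))) ∞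
        (fun x => (⟨x, weylTensor g V x (Y x) (X x)⟩ : TangentBundle (𝓡 n) M)) x₀ :=
    fun X Y x₀ hX hY => ContMDiffAt.sub_section
      (ContMDiffAt.add_section (ContMDiffAt.smul_section (g.contMDiffAt_inner (hV x₀) hX) hY)
        (ContMDiffAt.smul_section (g.contMDiffAt_inner hY (hV x₀)) hX))
      (ContMDiffAt.smul_section (g.contMDiffAt_inner hY hX) (hV x₀))
  -- `L` is the Weyl formula solved for `∇^g`. The added tensor is symmetric, so `L` is
  -- torsion-free, and its action on `g` cancels the Lee form term of `D`.
  let L := D.addTensor (weylTensor g V) hA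
  have hL : ∀ {Y : Π x : M, TangentSpace (𝓡 n) x} {x : M}, IsDiffFieldAt Y x →
      ∀ u : TangentSpace (𝓡 n) x, L.toFun Y x u = D.toFun Y x u +
        (g.inner x (V x) u • Y x + g.inner x (Y x) (V x) • u - g.inner x (Y x) u • V x) := by
    intro Y x hY u
    exact congrArg (fun T => T u) (D.addTensor_apply hA hY)
  refine ⟨hV, L, ⟨L.isCovariantDerivativeOnUniv, L.smooth.contMDiff, ?_, ?_⟩, ?_⟩
  · intro X Y x hx hX hY
    rw [hL hX, hL hY, ← hD X Y x hx hX hY, g.symm x (V x) (X x), g.symm x (V x) (Y x),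
      g.symm x (X x) (Y x)]
    abel
  · intro Y Z x hx hY hZ u
    have h := hθ.2 Y Z x hY hZ u
    rw [derivForm] at h ⊢
    rw [hL hY, hL hZ]
    simp only [map_add, map_sub, map_smul, add_apply, sub_apply, smul_apply, smul_eq_mul,
      neg_apply] at h ⊢
    rw [g.symm x u (Z x), g.symm x (V x) (Z x)]
    linear_combination h
  · intro Y x hY u
    rw [hL hY, g.symm x (V x) u, g.symm x (Y x) u]
    abel

/-- The Weyl connection of `(g, V)` exists as soon as the metric connection with vectorial torsion
does. -/
theorem IsVectorialConnection.exists_isWeylConnection {g : RiemMetric n M}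
    {V : Π x : M, TangentSpace (𝓡 n) x} {C : AffineConnection n M}
    (hC : IsVectorialConnection g V C) : ∃ D, IsWeylConnection g V D := by
  obtain ⟨hV, L, hL, hC⟩ := hC
  obtain ⟨D, hD⟩ := C.exists_add_oneForm (θ := fun x => -g.inner x (V x))
    (fun x => (g.isSmoothOneForm_flat hV x).neg_section)
  refine ⟨D, hV, L, hL, fun Y x hY u => ?_⟩
  have hneg : (-g.inner x (V x)) u = -g.inner x (V x) u := rfl
  rw [hD Y x hY, hC Y x hY, hneg, g.symm x (V x) u, g.symm x (V x) (Y x)]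
  module

/-- Adding `V^♭ ⊗ Id` to `D` gives the connection, with the same Levi-Civita connection as witness.
-/
theorem IsWeylConnection.exists_isVectorialConnection {g : RiemMetric n M}
    {V : Π x : M, TangentSpace (𝓡 n) x} {D : AffineConnection n M}
    (hD : IsWeylConnection g V D) : ∃ C, IsVectorialConnection g V C := by
  obtain ⟨hV, L, hL, hD⟩ := hD
  obtain ⟨C, hC⟩ := D.exists_add_oneForm (g.isSmoothOneForm_flat hV)
  refine ⟨C, hV, L, hL, fun Y x hY u => ?_⟩
  rw [hC Y x hY, hD Y x hY, g.symm x (V x) u, g.symm x (V x) (Y x)]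
  abel

theorem IsWeylConnection.eq {g : RiemMetric n M} {V : Π x : M, TangentSpace (𝓡 n) x}
    {D D' : AffineConnection n M} (hD : IsWeylConnection g V D) (hD' : IsWeylConnection g V D') :
    D = D' := by
  obtain ⟨-, L, hL, hD⟩ := hD
  obtain ⟨-, L', hL', hD'⟩ := hD'
  refine AffineConnection.ext_of_mdiff fun Y x hY => ?_
  ext1 u
  rw [hD Y x hY, hD' Y x hY, hL.apply_eq hL' hY]

theorem IsVectorialConnection.eq {g : RiemMetric n M} {V : Π x : M, TangentSpace (𝓡 n) x}
    {C C' : AffineConnection n M} (hC : IsVectorialConnection g V C)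
    (hC' : IsVectorialConnection g V C') : C = C' := by
  obtain ⟨-, L, hL, hC⟩ := hC
  obtain ⟨-, L', hL', hC'⟩ := hC'
  refine AffineConnection.ext_of_mdiff fun Y x hY => ?_
  ext1 u
  rw [hC Y x hY, hC' Y x hY, hL.apply_eq hL' hY]

/-- Flatness of a metric connection with vectorial torsion in terms of the Weyl connection. -/
theorem IsVectorialConnection.isFlat_iff [T2Space M] (hn : 3 ≤ n) {g : RiemMetric n M}
    {V : Π x : M, TangentSpace (𝓡 n) x} {C D : AffineConnection n M}
    (hC : IsVectorialConnection g V C) (hD : IsWeylConnection g V D) :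
    C.IsFlat ↔ IsClosedOneForm (fun x => g.inner x (V x)) ∧ D.IsFlat :=
  isFlat_iff_of_sub_oneForm hn (g.isSmoothOneForm_flat hC.1)
    (IsWeylConnection.apply_eq hC hD) hD.isTorsionFreeOn

/-! ### From flat vectorial structures to Weyl structures and local conformal flatness -/

theorem WeylStructure.eq_of_connection_eq {W W' : WeylStructure n M} (h : W.cls = W'.cls)
    (h' : W.connection = W'.connection) : W = W' := by
  cases W
  cases W'
  cases h
  cases h'
  rfl

/-- A closed flat Weyl structure from a flat metric connection with vectorial torsion. -/
theorem FlatVectorialStructure.exists_weylStructure [T2Space M] (hn : 3 ≤ n)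
    (S : FlatVectorialStructure n M) :
    ∃ W : {W : WeylStructure n M // W.IsClosedWeyl ∧ W.IsFlatWeyl},
      W.1.cls = conformalClass S.metric ∧
      ∀ V : Π x : M, TangentSpace (𝓡 n) x, IsVectorialConnection S.metric V S.connection →
        IsWeylConnection S.metric V W.1.connection := by
  obtain ⟨V, hV⟩ := S.vectorial
  obtain ⟨D, hD⟩ := hV.exists_isWeylConnection
  obtain ⟨hcl, hDf⟩ := (hV.isFlat_iff hn hD).1 S.flat
  have hsm := S.metric.isSmoothOneForm_flat hV.1
  -- Every metric of the class has a Lee form differing from `-V^♭` by an exact form; this serves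
  -- both the existence and the closedness of Lee forms.
  have hconf : ∀ g : RiemMetric n M, conformalClass g = conformalClass S.metric →
      ∃ f : M → ℝ, ContMDiff (𝓡 n) 𝓘(ℝ, ℝ) ∞ f ∧
        IsLeeForm g D (fun x => -S.metric.inner x (V x) - mvfderiv (𝓡 n) f x) := by
    intro g hg
    obtain ⟨f, hf, hgf⟩ : IsConformal S.metric g := Quotient.exact hg.symm
    exact ⟨f, hf, hD.isLeeForm.conformal hf hgf⟩
  refine ⟨⟨⟨conformalClass S.metric, D, hD.isTorsionFreeOn, fun g hg => ?_⟩, ?_, hDf⟩, rfl, ?_⟩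
  · obtain ⟨f, -, hf⟩ := hconf g hg
    exact ⟨_, hf⟩
  · intro g θ hg hθ
    obtain ⟨f, hf, hLee⟩ := hconf g hg
    rw [hθ.eq hLee]
    exact IsClosedOneForm.sub (fun x => (hsm x).neg_section) (isSmoothOneForm_mvfderiv hf)
      (IsClosedOneForm.neg hsm hcl) (isClosedOneForm_mvfderiv hf)
  · intro V' hV'
    -- `D` was built from one choice of `V`; the field is determined by the connection, so the
    -- choice does not matter.
    rwa [hV'.field_eq (by omega) hV]

/-- A smooth connection restricts to a smooth covariant derivative over every open set. -/
theorem AffineConnection.contMDiffCovariantDerivativeOn [T2Space M] (D : AffineConnection n M)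
    {U : Set M} (hU : IsOpen U) :
    ContMDiffCovariantDerivativeOn (EuclideanSpace ℝ (Fin n)) ∞ D.toFun U := by
  refine ⟨fun {σ} hσ x hx => ?_⟩
  have hσU : ContMDiffOn (𝓡 n) ((𝓡 n).prod 𝓘(ℝ, EuclideanSpace ℝ (Fin n))) ∞
    (fun y => (⟨y, σ y⟩ : TangentBundle (𝓡 n) M)) U := hσ
  obtain ⟨ψ, -, hψ⟩ := (SmoothBumpFunction.nhds_basis_tsupport (I := 𝓡 n) x).mem_iff.1
    (hU.mem_nhds hx)
  -- `σ` is smooth only over `U`. The cut-off field is globally smooth and agrees with `σ` near `x`,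
  -- and covariant derivatives are local.
  have hσ' : IsSmoothField ((ψ : M → ℝ) • σ) :=
    ContMDiffOn.smul_section_of_tsupport ψ.contMDiff.contMDiffOn hU hψ hσU
  have h := contMDiffOn_univ.1 (D.smooth.contMDiff.contMDiff (contMDiffOn_univ.2 hσ'))
  refine ((h x).congr_of_eventuallyEq ?_).contMDiffWithinAt
  filter_upwards [ψ.eventuallyEq_one.eventuallyEq_nhds, hU.mem_nhds hx] with y hy hyU
  have hσy : IsDiffFieldAt σ y := (hσU.contMDiffAt (hU.mem_nhds hyU)).mdifferentiableAt (by simp)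
  have e : D.toFun σ y = D.toFun ((ψ : M → ℝ) • σ) y := by
    refine D.isCovariantDerivativeOnUniv.congr_of_eventuallyEq hσy (hσ'.isDiffFieldAt y)
      Filter.univ_mem ?_
    filter_upwards [hy] with z hz
    simp [hz]
  exact congrArg (fun T => TotalSpace.mk' (EuclideanSpace ℝ (Fin n) →L[ℝ] EuclideanSpace ℝ (Fin n))
    (E := fun x : M => TangentSpace (𝓡 n) x →L[ℝ] TangentSpace (𝓡 n) x) y T) e

/-- A metric with a flat metric connection with vectorial torsion is locally conformally flat. -/
theorem FlatVectorialStructure.isLocallyConformallyFlat [T2Space M] (hn : 3 ≤ n)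
    (S : FlatVectorialStructure n M) : IsLocallyConformallyFlat S.metric := by
  intro p
  obtain ⟨V, hV⟩ := S.vectorial
  obtain ⟨D, hD⟩ := hV.exists_isWeylConnection
  obtain ⟨hcl, hDf⟩ := (hV.isFlat_iff hn hD).1 S.flat
  have hsm := S.metric.isSmoothOneForm_flat hV.1
  -- The sign is forced: `D g = 2 V^♭ ⊗ g`, so `e^{2f} g` is `D`-parallel when `df = -V^♭`.
  obtain ⟨U, hU, hpU, f, hf, hfV⟩ := IsClosedOneForm.exists_primitive
    (θ := fun x => -S.metric.inner x (V x)) (fun x => (hsm x).neg_section)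
    (IsClosedOneForm.neg hsm hcl) p
  refine ⟨U, hU, hpU, f, hf, D.toFun, ⟨D.isCovariantDerivativeOnUniv.mono (subset_univ U), ?_,
    fun X Y x _ => hD.isTorsionFreeOn X Y x (mem_univ x), ?_⟩,
    fun X Y Z hX hY hZ x _ => hDf X Y Z hX hY hZ x (mem_univ x)⟩
  · exact D.contMDiffCovariantDerivativeOn hU
  · intro Y Z x hx hY hZ u
    rw [derivForm_exp_smul _ _ ((hf.contMDiffAt (hU.mem_nhds hx)).mdifferentiableAt (by simp))
      hY hZ, hD.isLeeForm.2 Y Z x hY hZ u, hfV x hx]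
    ring

end VectorialTorsion

/-! ### The main theorem -/

theorem mainTheorem8 (n : ℕ) (hn : 3 ≤ n) (M : Type*) [TopologicalSpace M] [T2Space M]
    [SecondCountableTopology M] [ChartedSpace (EuclideanSpace ℝ (Fin n)) M]
    [IsManifold (𝓡 n) ∞ M] :
    -- `∇` is flat if and only if `dV = 0` and the Weyl connection is flat
    (∀ (g : VectorialTorsion.RiemMetric n M) (V : Π x : M, TangentSpace (𝓡 n) x)
        (C D : VectorialTorsion.AffineConnection n M),
        VectorialTorsion.IsVectorialConnection g V C → VectorialTorsion.IsWeylConnection g V D →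
          (C.IsFlat ↔
            VectorialTorsion.IsClosedOneForm (fun x => g.inner x (V x)) ∧ D.IsFlat)) ∧
    -- the correspondence `(g, ∇) ↦ ([g], ∇^w)`, one-to-one over each metric of the class
    (∃ Φ : VectorialTorsion.FlatVectorialStructure n M →
        {W : VectorialTorsion.WeylStructure n M // W.IsClosedWeyl ∧ W.IsFlatWeyl},
      (∀ S, (Φ S).1.cls = VectorialTorsion.conformalClass S.metric) ∧
      (∀ S, ∀ V : Π x : M, TangentSpace (𝓡 n) x,
        VectorialTorsion.IsVectorialConnection S.metric V S.connection →
          VectorialTorsion.IsWeylConnection S.metric V (Φ S).1.connection) ∧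
      ∀ W, ∀ g : VectorialTorsion.RiemMetric n M, VectorialTorsion.conformalClass g = W.1.cls →
        ∃! S : VectorialTorsion.FlatVectorialStructure n M, S.metric = g ∧ Φ S = W) ∧
    -- such manifolds are locally conformally flat
    (∀ S : VectorialTorsion.FlatVectorialStructure n M,
      VectorialTorsion.IsLocallyConformallyFlat S.metric) := by
  refine ⟨fun g V C D hC hD => hC.isFlat_iff hn hD, ?_, fun S => S.isLocallyConformallyFlat hn⟩
  choose Φ hcls hweyl using fun S : VectorialTorsion.FlatVectorialStructure n M =>
    S.exists_weylStructure hn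
  refine ⟨Φ, hcls, hweyl, fun W g hg => ?_⟩
  obtain ⟨θ, hθ⟩ := W.1.preserves g hg
  -- The Lee form of the Weyl connection of `(g, V)` is `-V^♭`, so `V` has to be dual to `-θ`.
  obtain ⟨V, hVθ⟩ := g.exists_flat_eq (fun x => -θ x)
  have hVsm : VectorialTorsion.IsSmoothOneForm (fun x => g.inner x (V x)) := by
    simp only [hVθ]
    exact fun x => (hθ.1 x).neg_section
  have hV := g.isSmoothField_of_flat hVsm
  have hθV : θ = fun x => -g.inner x (V x) := by
    funext x
    rw [hVθ, neg_neg]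
  have hD : VectorialTorsion.IsWeylConnection g V W.1.connection :=
    .of_isLeeForm hV W.1.torsionFree (hθV ▸ hθ)
  have hcl : VectorialTorsion.IsClosedOneForm (fun x => g.inner x (V x)) := by
    simp only [hVθ]
    exact (W.2.1 g θ hg hθ).neg hθ.1
  obtain ⟨C, hC⟩ := hD.exists_isVectorialConnection
  refine ⟨⟨g, C, ⟨V, hC⟩, (hC.isFlat_iff hn hD).2 ⟨hcl, W.2.2⟩⟩, ⟨rfl, Subtype.ext ?_⟩, ?_⟩
  · exact VectorialTorsion.WeylStructure.eq_of_connection_eq ((hcls _).trans hg)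
      ((hweyl _ V hC).eq hD)
  · rintro S' ⟨hSg, hSW⟩
    have hw := hweyl S'
    rw [hSW] at hw
    obtain ⟨g', C', ⟨V', hV'⟩, hflat⟩ := S'
    obtain rfl : g' = g := hSg
    -- Both fields give the same Weyl connection with the same metric, so their Lee forms, and hence
    -- the fields, agree.
    have hVV : V' = V := by
      funext x
      refine g'.eq_of_forall_inner_eq fun u => ?_
      have := congrFun ((hw V' hV').isLeeForm.eq hD.isLeeForm) x
      exact congrArg (fun φ => φ u) (neg_injective this)
    subst hVV
    obtain rfl : C' = C := hV'.eq hC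
    rfl
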